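/- Let $(W_t)_{t\in[0,1]}$ be a standard Brownian motion on a probability space $(\Omega,\mathcal F,P)$ and let $I:L^2([0,1])\to L^2(\Omega)$ be the Wiener integral, i.e. the continuous linear extension of $\mathbf 1_{(0,t]}\mapsto W_t$. For $\alpha\ge 0$ let $h^k_\alpha$ be the Hermite polynomials with $h^0_\alpha=1$, $h^1_\alpha(x)=x$, $h^{k+2}_\alpha(x)=x\,h^{k+1}_\alpha(x)-(k+1)\alpha\,h^{k}_\alpha(x)$, and write $X^{\diamond k}=h^k_\alpha(X)$ for the Wick powers of a centred Gaussian variable $X$ of variance $\alpha$. Let $f,g\in L^2([0,1])$ be differentiable on $[0,1]$ with derivatives $f',g'$ of bounded variation, and let $(a_k)_{k\ge0}$, $(b_k)_{k\ge0}$ be real sequences with $\sup_{k\ge1}(k!\,|a_k|)^{1/k}<\infty$ and $\sup_{k\ge1}(k!\,|b_k|)^{1/k}<\infty$. Put $$F(I(f))=\sum_{k\ge0}a_k\,I(f)^{\diamond k},\qquad G(I(g))=\sum_{k\ge0}b_k\,I(g)^{\diamond k},$$ where $F(x)=\sum_k a_k h^k_{\|f\|^2}(x)$ and $G(x)=\sum_k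 b_k h^k_{\|g\|^2}(x)$ for $x\in\mathbb R$ (both series converge absolutely everywhere), and let $F',G'$ be the derivatives of these functions. For $n\ge1$ and $X\in L^2(\Omega)$ let $\widehat X^n=E[X\mid W_{1/n},W_{2/n},\dots,W_1]$. With $\Delta=1/n$, $f_k=f(k/n)$, $f'_k=f'(k/n)$, put $$I^n(f)=\sum_{k=0}^{n-1}\Bigl(f_k+\tfrac{\Delta}{2}f'_k\Bigr)\bigl(W_{(k+1)/n}-W_{k/n}\bigr),\qquad \|f\|_n^2=\Delta\sum_{k=0}^{n-1}\Bigl(f_k+\tfrac{\Delta}{2}f'_k\Bigr)^2,$$ $$\widetilde F^{(n)}=\sum_{m=0}^{n}a_m\,h^m_{\|f\|_n^2}\bigl(I^n(f)\bigr),$$ and define $\widetilde G^{(n)}$ in the same way from $g$ and $(b_m)$. Then $F(I(f)),F'(I(f)),G(I(g)),G'(I(g))\in L^2(\Omega)$, and, abbreviating $F=F(I(f))$ and $G=G(I(g))$, for every choice $$(x_n,y_n)\in\bigl\{F-\widehat F^n,\;F-\widetilde F^{(n)}\bigr\}\times\bigl\{G-\widehat G^n,\;G-\widetilde G^{(n)}\bigr\}$$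 the products $x_ny_n$ are integrable and $$\lim_{n\to\infty}n^2\,E[x_ny_n]=\frac1{12}\Bigl(\int_0^1 f'(s)g'(s)\,ds\Bigr)\,E\bigl[F'(I(f))\,G'(I(g))\bigr].$$ -/

import Mathlib

open MeasureTheory ProbabilityTheory Filter Topology Set
open scoped ENNReal NNReal

noncomputable section

namespace WickApprox

/-! ### Brownian motion on `[0,1]` and the Wiener integral -/

/-- Lebesgue measure on `[0,1]`, seen as a measure on `ℝ`; `L²([0,1])` is `Lp ℝ 2 unitMeasure`. -/
def unitMeasure : Measure ℝ := volume.restrict (Icc 0 1)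

instance : IsFiniteMeasure unitMeasure := by
  unfold unitMeasure; infer_instance

/-- `W` is a (standard, real) Brownian motion on `[0,1]`: a centred Gaussian process with
covariance `min s t` and almost surely continuous paths. -/
structure IsBrownianMotion {Ω : Type*} [MeasurableSpace Ω] (W : unitInterval → Ω → ℝ)
    (P : Measure Ω) : Prop where
  measurable : ∀ t, Measurable (W t)
  gaussian : IsGaussianProcess W P
  mean : ∀ t, ∫ ω, W t ω ∂P = 0
  covariance : ∀ s t, cov[W s, W t; P] = min (s : ℝ) (t : ℝ)
  continuous : ∀ᵐ ω ∂P, Continuous fun t => W t ω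

variable {Ω : Type*} [MeasurableSpace Ω] {P : Measure Ω} {W : unitInterval → Ω → ℝ}

lemma IsBrownianMotion.memLp (hW : IsBrownianMotion W P) (t : unitInterval) :
    MemLp (W t) 2 P :=
  (hW.gaussian.hasGaussianLaw_eval t).memLp_two

/-- The element `𝟙_{(0,t]}` of `L²([0,1])`. -/
def indicatorL2 (t : unitInterval) : Lp ℝ 2 unitMeasure :=
  indicatorConstLp 2 (measurableSet_Ioc (a := (0 : ℝ)) (b := (t : ℝ)))
    (measure_ne_top unitMeasure _) 1

/-- The step function `∑ c_t 𝟙_{(0,t]}` in `L²([0,1])`. -/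
def stepL2 : (unitInterval →₀ ℝ) →ₗ[ℝ] Lp ℝ 2 unitMeasure :=
  Finsupp.linearCombination ℝ indicatorL2

/-- The random variable `∑ c_t W_t` in `L²(Ω)`. -/
def stepIntegral (hW : IsBrownianMotion W P) : (unitInterval →₀ ℝ) →ₗ[ℝ] Lp ℝ 2 P :=
  Finsupp.linearCombination ℝ fun t => (hW.memLp t).toLp (W t)

/-- The Wiener integral `I : L²([0,1]) → L²(Ω)`: the continuous linear extension of
`𝟙_{(0,t]} ↦ W_t`. -/
def wienerIntegral (hW : IsBrownianMotion W P) : Lp ℝ 2 unitMeasure →L[ℝ] Lp ℝ 2 P :=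
  (stepIntegral hW).extendOfNorm stepL2

lemma inner_indicatorL2 (s t : unitInterval) :
    inner ℝ (indicatorL2 s) (indicatorL2 t) = min (s : ℝ) (t : ℝ) := by
  rw [indicatorL2, indicatorL2, L2.inner_indicatorConstLp_one]
  rw [setIntegral_congr_ae (g := (Ioc (0 : ℝ) t).indicator fun _ => (1 : ℝ)) measurableSet_Ioc
    ((indicatorConstLp_coeFn (p := 2) (hs := measurableSet_Ioc (a := (0 : ℝ)) (b := (t : ℝ)))
      (hμs := measure_ne_top unitMeasure _) (c := (1 : ℝ))).mono fun x hx _ => hx)]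
  have hs := s.2
  have ht := t.2
  rw [setIntegral_indicator measurableSet_Ioc, Ioc_inter_Ioc, setIntegral_const, unitMeasure,
    measureReal_restrict_apply measurableSet_Ioc, inter_eq_left.2]
  · simp [le_min hs.1 ht.1]
  · intro x hx
    simp only [mem_Ioc, sup_idem, le_inf_iff] at hx
    exact ⟨hx.1.le, hx.2.1.trans hs.2⟩

lemma inner_brownian (hW : IsBrownianMotion W P) (s t : unitInterval) :
    inner ℝ ((hW.memLp s).toLp (W s)) ((hW.memLp t).toLp (W t)) = min (s : ℝ) (t : ℝ) := by
  rw [L2.inner_def, ← hW.covariance s t]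
  have := hW.gaussian.isProbabilityMeasure
  rw [covariance_eq_sub (hW.memLp s) (hW.memLp t), hW.mean, hW.mean, mul_zero, sub_zero]
  refine integral_congr_ae ?_
  filter_upwards [(hW.memLp s).coeFn_toLp, (hW.memLp t).coeFn_toLp] with ω h1 h2
  simp [h1, h2, mul_comm]

lemma norm_stepIntegral (hW : IsBrownianMotion W P) (c : unitInterval →₀ ℝ) :
    ‖stepIntegral hW c‖ = ‖stepL2 c‖ := by
  have h : ‖stepIntegral hW c‖ ^ 2 = ‖stepL2 c‖ ^ 2 := by
    rw [← real_inner_self_eq_norm_sq, ← real_inner_self_eq_norm_sq, stepIntegral, stepL2,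
      Finsupp.linearCombination_apply, Finsupp.linearCombination_apply]
    simp only [Finsupp.sum, sum_inner, inner_sum, real_inner_smul_left, real_inner_smul_right,
      inner_indicatorL2]
    exact Finset.sum_congr rfl fun s _ => Finset.sum_congr rfl fun t _ => by
      rw [inner_brownian hW]
  exact (sq_eq_sq₀ (norm_nonneg _) (norm_nonneg _)).1 h

lemma denseRange_stepL2 : DenseRange stepL2 := by
  have hr : (LinearMap.range stepL2).topologicalClosure = ⊤ := by
    rw [Submodule.topologicalClosure_eq_top_iff, Submodule.eq_bot_iff]
    intro f hf
    have hfi : Integrable f unitMeasure := (Lp.memLp f).integrable one_le_two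
    have h0 (t : unitInterval) : ∫ x in Ioc (0 : ℝ) t, f x ∂unitMeasure = 0 := by
      have := (Submodule.mem_orthogonal _ f).1 hf (indicatorL2 t)
        ⟨Finsupp.single t 1, by simp [stepL2]⟩
      rwa [indicatorL2, L2.inner_indicatorConstLp_one] at this
    have hproj (c : ℝ) : ∫ x in Iic c, f x ∂unitMeasure = 0 := by
      rw [← h0 (projIcc 0 1 zero_le_one c)]
      refine setIntegral_congr_set ?_
      have hne : ∀ᵐ x ∂unitMeasure, x ≠ 0 := by
        rw [unitMeasure]
        exact ae_restrict_of_ae (Measure.ae_ne volume 0)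
      have hmem : ∀ᵐ x ∂unitMeasure, x ∈ Icc (0 : ℝ) 1 := ae_restrict_mem measurableSet_Icc
      filter_upwards [hne, hmem] with x hx hx'
      have : 0 < x := lt_of_le_of_ne hx'.1 (Ne.symm hx)
      refine propext ?_
      change x ≤ c ↔ 0 < x ∧ x ≤ ((projIcc 0 1 zero_le_one c : unitInterval) : ℝ)
      rw [coe_projIcc]
      simp only [le_max_iff, le_min_iff, this, true_and, hx'.2, not_le.2 this, false_or]
    have huniv : ∫ x, f x ∂unitMeasure = 0 := by
      rw [← h0 1]
      rw [← setIntegral_univ]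
      refine setIntegral_congr_set ?_
      have hne : ∀ᵐ x ∂unitMeasure, x ≠ 0 := by
        rw [unitMeasure]
        exact ae_restrict_of_ae (Measure.ae_ne volume 0)
      have hmem : ∀ᵐ x ∂unitMeasure, x ∈ Icc (0 : ℝ) 1 := ae_restrict_mem measurableSet_Icc
      filter_upwards [hne, hmem] with x hx hx'
      exact propext ⟨fun _ => ⟨lt_of_le_of_ne hx'.1 (Ne.symm hx), hx'.2⟩, fun _ => trivial⟩
    have hall : ∀ s, MeasurableSet s → ∫ x in s, f x ∂unitMeasure = 0 := by
      intro s hs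
      induction s, hs using MeasurableSpace.induction_on_inter
        (borel_eq_generateFrom_Iic ℝ ▸ (BorelSpace.measurable_eq (α := ℝ))) isPiSystem_Iic with
      | empty => simp
      | basic t ht => obtain ⟨c, rfl⟩ := ht; exact hproj c
      | compl t ht ih =>
        have := integral_add_compl ht hfi
        rw [ih, zero_add] at this
        rw [this, huniv]
      | iUnion t hd ht ih =>
        rw [integral_iUnion ht hd hfi.integrableOn]
        simp [ih]
    have hae : f =ᵐ[unitMeasure] 0 :=
      hfi.ae_eq_zero_of_forall_setIntegral_eq_zero fun s hs _ => hall s hs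
    exact (Lp.eq_zero_iff_ae_eq_zero).2 hae
  have := (Submodule.dense_iff_topologicalClosure_eq_top).2 hr
  rwa [LinearMap.coe_range] at this

/-- The Wiener integral does extend `𝟙_{(0,t]} ↦ W_t`. -/
lemma wienerIntegral_indicatorL2 (hW : IsBrownianMotion W P) (t : unitInterval) :
    wienerIntegral hW (indicatorL2 t) = (hW.memLp t).toLp (W t) := by
  have h := LinearMap.extendOfNorm_eq (f := stepIntegral hW) denseRange_stepL2
    ⟨1, fun c => by rw [norm_stepIntegral hW c, one_mul]⟩ (Finsupp.single t 1)
  simpa [stepL2, stepIntegral, wienerIntegral] using h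

/-- The random variable `I(f)` of a square integrable function `f` on `[0,1]`. -/
def wienerInt (hW : IsBrownianMotion W P) (f : ℝ → ℝ) (hf : MemLp f 2 unitMeasure) : Ω → ℝ :=
  wienerIntegral hW (hf.toLp f)

/-! ### Wick powers and Wick-analytic functionals -/

/-- The Hermite polynomial `h^k_α` with variance parameter `α`, through the three-term recursion
`h^{k+2}_α(x) = x h^{k+1}_α(x) - (k+1) α h^k_α(x)`. The Wick powers of a centred Gaussian variable
`X` with variance `α` are `X^{⋄k} = h^k_α(X)`. -/
def hermiteVar (α : ℝ) : ℕ → ℝ → ℝ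
  | 0, _ => 1
  | 1, x => x
  | k + 2, x => x * hermiteVar α (k + 1) x - (k + 1) * α * hermiteVar α k x

/-- For `α > 0` this is Rodrigues' formula
`h^k_α(x) = (-α)^k exp(x²/(2α)) (d/dx)^k exp(-x²/(2α))`. -/
lemma hermiteVar_eq_rodrigues {α : ℝ} (hα : 0 < α) (k : ℕ) (x : ℝ) :
    hermiteVar α k x = (-α) ^ k * Real.exp (x ^ 2 / (2 * α)) *
      iteratedDeriv k (fun y => Real.exp (-y ^ 2 / (2 * α))) x := by
  have hder (y : ℝ) (j : ℕ) :
      HasDerivAt (hermiteVar α j) (j * hermiteVar α (j - 1) y) y ∧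
      HasDerivAt (hermiteVar α (j + 1)) ((j + 1) * hermiteVar α j y) y := by
    induction j with
    | zero =>
      refine ⟨?_, ?_⟩
      · simpa [hermiteVar] using! hasDerivAt_const y (1 : ℝ)
      · simpa [hermiteVar] using! hasDerivAt_id y
    | succ j ih =>
      refine ⟨by simpa using ih.2, ?_⟩
      have h := ((hasDerivAt_id y).mul ih.2).sub (ih.1.const_mul (((j : ℝ) + 1) * α))
      refine h.congr_deriv ?_
      rcases j with _ | j
      · simp [hermiteVar]; ring
      · simp only [id, hermiteVar, Nat.add_sub_cancel]; push_cast; ring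
  have hrec (y : ℝ) (j : ℕ) :
      hermiteVar α (j + 1) y = y * hermiteVar α j y - α * (j * hermiteVar α (j - 1) y) := by
    rcases j with _ | j
    · simp [hermiteVar]
    · simp only [hermiteVar, Nat.add_sub_cancel]; push_cast; ring
  have hit : ∀ j, iteratedDeriv j (fun y => Real.exp (-y ^ 2 / (2 * α))) =
      fun y => (-(1 / α)) ^ j * (hermiteVar α j y * Real.exp (-y ^ 2 / (2 * α))) := by
    intro j
    induction j with
    | zero => simp [hermiteVar]
    | succ j ih =>
      rw [iteratedDeriv_succ, ih]
      funext y
      have he : HasDerivAt (fun y : ℝ => Real.exp (-y ^ 2 / (2 * α)))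
          (Real.exp (-y ^ 2 / (2 * α)) * (-(2 * y) / (2 * α))) y := by
        have : HasDerivAt (fun y : ℝ => -y ^ 2 / (2 * α)) (-(2 * y) / (2 * α)) y := by
          simpa using! ((hasDerivAt_pow 2 y).neg.div_const (2 * α))
        exact this.exp
      have hd : HasDerivAt
          (fun y => (-(1 / α)) ^ j * (hermiteVar α j y * Real.exp (-y ^ 2 / (2 * α)))) _ y :=
        ((hder y j).1.mul he).const_mul ((-(1 / α)) ^ j)
      rw [hd.deriv, hrec y j, pow_succ (-(1 / α)) j]
      generalize (-(1 / α)) ^ j = p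
      generalize Real.exp (-y ^ 2 / (2 * α)) = q
      field_simp
      ring
  rw [hit k]
  have h1 : (-α) ^ k * (-(1 / α)) ^ k = 1 := by
    rw [← mul_pow]; field_simp; simp
  have h2 : Real.exp (x ^ 2 / (2 * α)) * Real.exp (-x ^ 2 / (2 * α)) = 1 := by
    rw [← Real.exp_add, neg_div, add_neg_cancel, Real.exp_zero]
  linear_combination (-hermiteVar α k x) * h1 - (-α) ^ k * (-(1 / α)) ^ k * hermiteVar α k x * h2

/-- The growth condition `sup_{k ≥ 1} (k! |a_k|)^{1/k} < ∞` on the coefficients of a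
Wick-analytic functional. -/
def IsWickAnalytic (a : ℕ → ℝ) : Prop :=
  BddAbove {r : ℝ | ∃ k : ℕ, 1 ≤ k ∧ r = ((k.factorial : ℝ) * |a k|) ^ (1 / (k : ℝ))}

/-- The real function `x ↦ ∑_k a_k h^k_α(x)`. -/
def wickSeries (a : ℕ → ℝ) (α x : ℝ) : ℝ := ∑' k, a k * hermiteVar α k x

/-- The series defining `wickSeries` converges absolutely at every point. -/
lemma IsWickAnalytic.summable {a : ℕ → ℝ} (ha : IsWickAnalytic a) (α x : ℝ) :
    Summable fun k => a k * hermiteVar α k x := by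
  set D : ℝ := 1 + |x| + |α| with hD
  have hx := abs_nonneg x
  have hα := abs_nonneg α
  have hD1 : 1 ≤ D := by linarith
  have hbound : ∀ k, |hermiteVar α k x| ≤ √(k.factorial) * D ^ k ∧
      |hermiteVar α (k + 1) x| ≤ √((k + 1).factorial) * D ^ (k + 1) := by
    intro k
    induction k with
    | zero => simp [hermiteVar]; linarith
    | succ k ih =>
      refine ⟨ih.2, ?_⟩
      have h1 : √((k + 1).factorial : ℝ) ≤ √((k + 2).factorial : ℝ) :=
        Real.sqrt_le_sqrt (by exact_mod_cast Nat.factorial_le (by omega))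
      have h2 : ((k : ℝ) + 1) * √(k.factorial : ℝ) ≤ √((k + 2).factorial : ℝ) := by
        refine Real.le_sqrt_of_sq_le ?_
        rw [mul_pow, Real.sq_sqrt (by positivity), Nat.factorial_succ, Nat.factorial_succ]
        push_cast
        have : (0 : ℝ) < k.factorial := by positivity
        nlinarith [mul_pos this (by positivity : (0 : ℝ) < k + 1)]
      calc |hermiteVar α (k + 2) x|
          = |x * hermiteVar α (k + 1) x - (k + 1) * α * hermiteVar α k x| := by rw [hermiteVar]
        _ ≤ |x| * |hermiteVar α (k + 1) x| + (k + 1) * |α| * |hermiteVar α k x| := by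
          refine (abs_sub _ _).trans ?_
          rw [abs_mul, abs_mul, abs_mul, abs_of_nonneg (by positivity : (0 : ℝ) ≤ k + 1)]
        _ ≤ |x| * (√((k + 1).factorial) * D ^ (k + 1)) +
            (k + 1) * |α| * (√(k.factorial) * D ^ k) := by
          gcongr
          exacts [ih.2, ih.1]
        _ = √((k + 1).factorial) * (|x| * D ^ (k + 1)) +
            ((k + 1) * √(k.factorial)) * (|α| * D ^ k) := by ring
        _ ≤ √((k + 2).factorial) * (|x| * D ^ (k + 1)) +
            √((k + 2).factorial) * (|α| * D ^ k) := by gcongr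
        _ = √((k + 2).factorial) * (D ^ k * (|x| * D + |α|)) := by ring
        _ ≤ √((k + 2).factorial) * (D ^ k * D ^ 2) := by
          gcongr
          nlinarith
        _ = _ := by ring
  obtain ⟨C, hC⟩ := ha
  set E : ℝ := max C 0 with hE
  have hE0 : 0 ≤ E := le_max_right _ _
  have hcoef (k : ℕ) (hk : 1 ≤ k) : (k.factorial : ℝ) * |a k| ≤ E ^ k := by
    have h := (hC ⟨k, hk, rfl⟩).trans (le_max_left C 0)
    have hnn : 0 ≤ (k.factorial : ℝ) * |a k| := by positivity
    have h' := pow_le_pow_left₀ (Real.rpow_nonneg hnn _) h k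
    rwa [one_div, Real.rpow_inv_natCast_pow hnn (by omega)] at h'
  set r : ℝ := E * D
  have hmaj : Summable fun k : ℕ => (2 * r ^ 2) ^ k / (k.factorial : ℝ) + (1 / 2 : ℝ) ^ k :=
    (Real.summable_pow_div_factorial _).add
      (summable_geometric_of_lt_one (by norm_num) (by norm_num))
  refine (summable_nat_add_iff 1).1 (Summable.of_norm_bounded
    ((summable_nat_add_iff 1).2 hmaj) fun j => ?_)
  obtain ⟨k, hk⟩ : ∃ k, k = j + 1 := ⟨_, rfl⟩
  rw [← hk, Real.norm_eq_abs, abs_mul]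
  have hf : (0 : ℝ) < k.factorial := by positivity
  have hsq : √(k.factorial : ℝ) ^ 2 = k.factorial := Real.sq_sqrt hf.le
  have hs : 0 < √(k.factorial : ℝ) := Real.sqrt_pos.2 hf
  have ha' : |a k| ≤ E ^ k / k.factorial := by
    rw [le_div_iff₀ hf, mul_comm]; exact hcoef k (by omega)
  have ht : (0 : ℝ) < 2 ^ k := by positivity
  set u : ℝ := r ^ k / √(k.factorial : ℝ) with hu
  have hu1 : E ^ k / k.factorial * (√(k.factorial : ℝ) * D ^ k) = u := by
    rw [hu, mul_pow, div_mul_eq_mul_div, div_eq_div_iff hf.ne' hs.ne']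
    linear_combination E ^ k * D ^ k * hsq
  have hu2 : (2 * r ^ 2) ^ k / (k.factorial : ℝ) = u ^ 2 * 2 ^ k := by
    rw [hu, div_pow, hsq, mul_pow, ← pow_mul, ← pow_mul]; ring
  have hu0 : 0 ≤ u := by positivity
  calc |a k| * |hermiteVar α k x|
      ≤ E ^ k / k.factorial * (√(k.factorial : ℝ) * D ^ k) :=
        mul_le_mul ha' (hbound k).1 (abs_nonneg _) (by positivity)
    _ = u := hu1
    _ ≤ u ^ 2 * 2 ^ k + 1 / 2 ^ k := by
      rw [← sub_nonneg]
      have : u ^ 2 * 2 ^ k + 1 / 2 ^ k - u = ((u * 2 ^ k - 1) ^ 2 + u * 2 ^ k) / 2 ^ k := by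
        field_simp; ring
      rw [this]; positivity
    _ = _ := by rw [hu2, one_div_pow]

/-- `‖f‖²` in `L²([0,1])`. -/
def normSq (f : ℝ → ℝ) : ℝ := ∫ s in (0 : ℝ)..1, f s ^ 2

/-- The Wick-analytic functional `F(I(f)) = ∑_k a_k I(f)^{⋄k}`. -/
def wickFunctional (hW : IsBrownianMotion W P) (f : ℝ → ℝ) (hf : MemLp f 2 unitMeasure)
    (a : ℕ → ℝ) (ω : Ω) : ℝ :=
  wickSeries a (normSq f) (wienerInt hW f hf ω)

/-- `F'(I(f))`, where `F'` is the derivative of the real function `F = ∑_k a_k h^k_{‖f‖²}`. -/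
def wickFunctionalDeriv (hW : IsBrownianMotion W P) (f : ℝ → ℝ) (hf : MemLp f 2 unitMeasure)
    (a : ℕ → ℝ) (ω : Ω) : ℝ :=
  deriv (wickSeries a (normSq f)) (wienerInt hW f hf ω)

/-! ### The class of integrands -/

/-- The derivative of `f` as a function on `[0,1]` (one-sided at the end points). -/
def unitDeriv (f : ℝ → ℝ) : ℝ → ℝ := derivWithin f (Icc 0 1)

/-- `f' ∈ BV`: `f ∈ L²([0,1])` is differentiable on `[0,1]` with derivative of bounded
variation. -/
structure HasBVDeriv (f : ℝ → ℝ) : Prop where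
  memLp : MemLp f 2 unitMeasure
  differentiable : DifferentiableOn ℝ f (Icc 0 1)
  boundedVariation : BoundedVariationOn (unitDeriv f) (Icc 0 1)

/-! ### The two approximations -/

/-- The value of the Brownian motion at the grid point `i / n` (used for `i ≤ n`, `n ≥ 1`). -/
def gridValue (W : unitInterval → Ω → ℝ) (n i : ℕ) : Ω → ℝ :=
  W (projIcc (0 : ℝ) 1 zero_le_one ((i : ℝ) / n))

/-- The σ-algebra generated by `W_{1/n}, W_{2/n}, …, W_1`. -/
abbrev gridSigma (W : unitInterval → Ω → ℝ) (n : ℕ) : MeasurableSpace Ω :=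
  ⨆ i ∈ Finset.Icc 1 n, MeasurableSpace.comap (gridValue W n i) inferInstance

/-- The error `X - E[X | W_{1/n}, …, W_1]` of the optimal approximation of `X`. -/
def optimalError (W : unitInterval → Ω → ℝ) (P : Measure Ω) (X : Ω → ℝ) (n : ℕ) (ω : Ω) : ℝ :=
  X ω - (P[X | gridSigma W n]) ω

/-- The coefficient `f_k + f'_k Δ / 2`, with `Δ = 1/n`, `f_k = f(k/n)` and `f'_k = f'(k/n)`. -/
def schemeCoeff (f : ℝ → ℝ) (n k : ℕ) : ℝ :=
  f ((k : ℝ) / n) + unitDeriv f ((k : ℝ) / n) * (1 / (n : ℝ)) / 2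

/-- `I^n(f) = ∑_{k<n} (f_k + f'_k Δ / 2) (W_{(k+1)/n} - W_{k/n})`. -/
def schemeInt (W : unitInterval → Ω → ℝ) (f : ℝ → ℝ) (n : ℕ) (ω : Ω) : ℝ :=
  ∑ k ∈ Finset.range n, schemeCoeff f n k * (gridValue W n (k + 1) ω - gridValue W n k ω)

/-- `‖f‖²_n = Δ ∑_{k<n} (f_k + f'_k Δ / 2)²`, the variance of `I^n(f)`. -/
def schemeNormSq (f : ℝ → ℝ) (n : ℕ) : ℝ :=
  (1 / (n : ℝ)) * ∑ k ∈ Finset.range n, schemeCoeff f n k ^ 2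

/-- The chaos-truncated strong approximation `F̃^(n)(I^n(f)) = ∑_{m=0}^n a_m (I^n(f))^{⋄m}`. -/
def truncatedApprox (W : unitInterval → Ω → ℝ) (f : ℝ → ℝ) (a : ℕ → ℝ) (n : ℕ) (ω : Ω) : ℝ :=
  ∑ m ∈ Finset.range (n + 1), a m * hermiteVar (schemeNormSq f n) m (schemeInt W f n ω)

/-- The error `X - F̃^(n)(I^n(f))` of the chaos-truncated strong approximation. -/
def truncatedError (W : unitInterval → Ω → ℝ) (f : ℝ → ℝ) (a : ℕ → ℝ) (X : Ω → ℝ)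
    (n : ℕ) (ω : Ω) : ℝ :=
  X ω - truncatedApprox W f a n ω

end WickApprox

end

namespace WickApprox

/-! ### Hermite polynomials and the Gaussian law -/

/-! Wick powers of Gaussian variables are orthogonal across degrees, so the expectation of a product
of two Wick series with integrands `u`, `v` depends only on `⟨u, v⟩`: it is `φ(⟨u, v⟩)` with `φ(z) =
∑ a_k b_k k! z^k` (`inner_wickVector`). This turns the probabilistic limit into Hilbert space
geometry in `L²([0,1])` and one entire power series.

Conditioning on the grid values replaces the integrand by its orthogonal projection onto the space
`V_n` of grid step functions (`condExp_wickVector`). The truncated scheme uses another element of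
`V_n` and drops the coefficients beyond `n`. For both approximations `f - u_n = d_n + O(n^(-3/2))`.
The leading error `d_n`, namely `f'(k/n)` times the distance to the cell midpoint, has size `1/n`,
is orthogonal to `V_n`, and is the same in both cases (`exists_hasLeadingError`).

Apart from exponentially small truncation terms, the expected product of errors is `φ(⟨f,g⟩) -
φ(⟨u,g⟩) - φ(⟨f,v⟩) + φ(⟨u,v⟩)`. By orthogonality of `d_n` to `V_n` each argument is within
`O(n^(-3/2))` of `⟨f,g⟩`, so quadratic Taylor remainders are `O(n^(-3))`, and the linear terms
combine to `φ'(⟨f,g⟩) ⟨f-u, g-v⟩` (`HasLeadingError.tendsto_pairing`). Here `φ'(⟨f,g⟩)` is `E[F'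
G']`, and `n² ⟨f-u, g-v⟩` has the limit of `1/12` times Riemann sums of `f' g'`, where `1/12` is the
variance of a uniform variable on a unit cell. -/

lemma hermiteVar_succ (α : ℝ) (k : ℕ) (x : ℝ) :
    hermiteVar α (k + 1) x = x * hermiteVar α k x - α * (k * hermiteVar α (k - 1) x) := by
  rcases k with _ | k
  · simp [hermiteVar]
  · simp only [hermiteVar, Nat.add_sub_cancel]; push_cast; ring

lemma hasDerivAt_hermiteVar (α : ℝ) (k : ℕ) (x : ℝ) :
    HasDerivAt (hermiteVar α k) (k * hermiteVar α (k - 1) x) x := by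
  suffices h : HasDerivAt (hermiteVar α k) (k * hermiteVar α (k - 1) x) x ∧
      HasDerivAt (hermiteVar α (k + 1)) ((k + 1) * hermiteVar α k x) x from h.1
  induction k with
  | zero =>
    refine ⟨?_, ?_⟩
    · simpa [hermiteVar] using! hasDerivAt_const x (1 : ℝ)
    · simpa [hermiteVar] using! hasDerivAt_id x
  | succ j ih =>
    refine ⟨by simpa using ih.2, ?_⟩
    have h := ((hasDerivAt_id x).mul ih.2).sub (ih.1.const_mul (((j : ℝ) + 1) * α))
    refine h.congr_deriv ?_
    rcases j with _ | j
    · simp [hermiteVar]; ring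
    · simp only [id, hermiteVar, Nat.add_sub_cancel]; push_cast; ring

lemma continuous_hermiteVar (α : ℝ) (k : ℕ) : Continuous (hermiteVar α k) :=
  continuous_iff_continuousAt.2 fun x => (hasDerivAt_hermiteVar α k x).continuousAt

lemma measurable_hermiteVar (α : ℝ) (k : ℕ) : Measurable (hermiteVar α k) :=
  (continuous_hermiteVar α k).measurable

/-- With `x` of weight one and `α` of weight two the recursion is homogeneous. This extracts the
factor `c ^ k` when one integrand is projected onto another. -/
lemma hermiteVar_mul (c α : ℝ) (k : ℕ) (x : ℝ) :
    hermiteVar (c ^ 2 * α) k (c * x) = c ^ k * hermiteVar α k x := by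
  suffices h : hermiteVar (c ^ 2 * α) k (c * x) = c ^ k * hermiteVar α k x ∧
      hermiteVar (c ^ 2 * α) (k + 1) (c * x) = c ^ (k + 1) * hermiteVar α (k + 1) x from h.1
  induction k with
  | zero => simp [hermiteVar]
  | succ k ih =>
    refine ⟨ih.2, ?_⟩
    rw [hermiteVar, hermiteVar, ih.1, ih.2]
    ring

/-- The recursion preserves this growth because `(k + 1) √(k!) ≤ √((k + 2)!)`. The constant `D` is
left free so that one bound serves all `x` in a ball. -/
lemma abs_hermiteVar_le (α x : ℝ) {D : ℝ} (hD : 1 + |x| + |α| ≤ D) (k : ℕ) :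
    |hermiteVar α k x| ≤ √(k.factorial) * D ^ k := by
  have hx := abs_nonneg x
  have hα := abs_nonneg α
  have hD1 : 1 ≤ D := by linarith
  suffices hbound : |hermiteVar α k x| ≤ √(k.factorial) * D ^ k ∧
      |hermiteVar α (k + 1) x| ≤ √((k + 1).factorial) * D ^ (k + 1) from hbound.1
  induction k with
  | zero => simp [hermiteVar]; linarith
  | succ k ih =>
    refine ⟨ih.2, ?_⟩
    have h1 : √((k + 1).factorial : ℝ) ≤ √((k + 2).factorial : ℝ) :=
      Real.sqrt_le_sqrt (by exact_mod_cast Nat.factorial_le (by omega))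
    have h2 : ((k : ℝ) + 1) * √(k.factorial : ℝ) ≤ √((k + 2).factorial : ℝ) := by
      refine Real.le_sqrt_of_sq_le ?_
      rw [mul_pow, Real.sq_sqrt (by positivity), Nat.factorial_succ, Nat.factorial_succ]
      push_cast
      have : (0 : ℝ) < k.factorial := by positivity
      nlinarith [mul_pos this (by positivity : (0 : ℝ) < k + 1)]
    calc |hermiteVar α (k + 2) x|
        = |x * hermiteVar α (k + 1) x - (k + 1) * α * hermiteVar α k x| := by rw [hermiteVar]
      _ ≤ |x| * |hermiteVar α (k + 1) x| + (k + 1) * |α| * |hermiteVar α k x| := by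
        refine (abs_sub _ _).trans ?_
        rw [abs_mul, abs_mul, abs_mul, abs_of_nonneg (by positivity : (0 : ℝ) ≤ k + 1)]
      _ ≤ |x| * (√((k + 1).factorial) * D ^ (k + 1)) +
          (k + 1) * |α| * (√(k.factorial) * D ^ k) := by
        gcongr
        exacts [ih.2, ih.1]
      _ = √((k + 1).factorial) * (|x| * D ^ (k + 1)) +
          ((k + 1) * √(k.factorial)) * (|α| * D ^ k) := by ring
      _ ≤ √((k + 2).factorial) * (|x| * D ^ (k + 1)) +
          √((k + 2).factorial) * (|α| * D ^ k) := by gcongr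
      _ = √((k + 2).factorial) * (D ^ k * (|x| * D + |α|)) := by ring
      _ ≤ √((k + 2).factorial) * (D ^ k * D ^ 2) := by
        gcongr
        nlinarith
      _ = _ := by ring

/-- By Hölder with exponents `2p`, `2p`, variables with all finite moments are closed under
products. This settles every integrability question about polynomials in Gaussian variables. -/
lemma memLp_mul_of_forall {Ω : Type*} [MeasurableSpace Ω] {P : Measure Ω} {X Y : Ω → ℝ}
    (hX : ∀ p : ℝ≥0∞, p ≠ ∞ → MemLp X p P) (hY : ∀ p : ℝ≥0∞, p ≠ ∞ → MemLp Y p P)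
    (p : ℝ≥0∞) (hp : p ≠ ∞) : MemLp (fun ω => X ω * Y ω) p P := by
  have h2 : p * 2 ≠ ∞ := ENNReal.mul_ne_top hp (by simp)
  have : ENNReal.HolderTriple (p * 2) (p * 2) p := ⟨by
    rcases eq_or_ne p 0 with rfl | h0
    · simp
    rw [ENNReal.mul_inv (by simp) (by simp), ← mul_add, ENNReal.inv_two_add_inv_two, mul_one]⟩
  exact (hY _ h2).mul' (hX _ h2)

lemma memLp_hermiteVar_comp {Ω : Type*} [MeasurableSpace Ω] {P : Measure Ω} [IsFiniteMeasure P]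
    {X : Ω → ℝ} (hX : ∀ p : ℝ≥0∞, p ≠ ∞ → MemLp X p P) (α : ℝ) (k : ℕ) (p : ℝ≥0∞) (hp : p ≠ ∞) :
    MemLp (fun ω => hermiteVar α k (X ω)) p P := by
  suffices h : ∀ p : ℝ≥0∞, p ≠ ∞ → MemLp (fun ω => hermiteVar α k (X ω)) p P ∧
      MemLp (fun ω => hermiteVar α (k + 1) (X ω)) p P from (h p hp).1
  induction k with
  | zero => exact fun p hp => ⟨by simpa [hermiteVar] using memLp_const 1,
      by simpa [hermiteVar] using! hX p hp⟩
  | succ k ih =>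
    refine fun p hp => ⟨(ih p hp).2, ?_⟩
    have h1 := memLp_mul_of_forall hX (fun p hp => (ih p hp).2) p hp
    exact h1.sub ((ih p hp).1.const_mul (((k : ℝ) + 1) * α))

/-- Gaussian integration by parts. -/
lemma integral_mul_gaussianReal {v : ℝ≥0} {p p' : ℝ → ℝ} (hp : ∀ x, HasDerivAt p (p' x) x)
    (h0 : Integrable p (gaussianReal 0 v)) (h1 : Integrable p' (gaussianReal 0 v))
    (h2 : Integrable (fun x => x * p x) (gaussianReal 0 v)) :
    ∫ x, x * p x ∂gaussianReal 0 v = v * ∫ x, p' x ∂gaussianReal 0 v := by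
  -- For `v = 0` the law is the Dirac mass at `0` and both sides vanish; otherwise the density
  -- satisfies `ρ' = -(x / v) ρ`, and ordinary integration by parts applies.
  rcases eq_or_ne v 0 with rfl | hv
  · simp
  have hd (x : ℝ) : HasDerivAt (gaussianPDFReal 0 v) (-(x / v) * gaussianPDFReal 0 v x) x := by
    rw [gaussianPDFReal_def]
    have : HasDerivAt (fun y : ℝ => -(y - 0) ^ 2 / (2 * v)) (-(x / v)) x := by
      have hv' : (v : ℝ) ≠ 0 := by exact_mod_cast hv
      refine (((((hasDerivAt_id x).sub_const 0).pow 2).neg).div_const (2 * (v : ℝ))).congr_deriv ?_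
      simp
      field_simp
    refine (this.exp.const_mul _).congr_deriv (by ring)
  have hint {q : ℝ → ℝ} (hq : Integrable q (gaussianReal 0 v)) :
      Integrable (fun x => q x * gaussianPDFReal 0 v x) := by
    rw [gaussianReal_of_var_ne_zero _ hv, integrable_withDensity_iff_integrable_smul'
      (by fun_prop) (ae_of_all _ fun _ => by simp [gaussianPDF])] at hq
    refine hq.congr (ae_of_all _ fun x => ?_)
    simp [mul_comm]
  have h := integral_mul_deriv_eq_deriv_mul_of_integrable (u := p) (u' := p')
    (v := gaussianPDFReal 0 v) (v' := fun x => -(x / v) * gaussianPDFReal 0 v x)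
    (fun x _ => hp x) (fun x _ => hd x)
    (((hint h2).const_mul (-1 / (v : ℝ))).congr (ae_of_all _ fun x => by simp; ring))
    (hint h1) (hint h0)
  rw [integral_gaussianReal_eq_integral_smul hv, integral_gaussianReal_eq_integral_smul hv]
  have hv' : (v : ℝ) ≠ 0 := by exact_mod_cast hv
  calc ∫ x, gaussianPDFReal 0 v x • (x * p x)
      = -v * ∫ x, p x * (-(x / v) * gaussianPDFReal 0 v x) := by
        rw [← integral_const_mul]
        refine integral_congr_ae (ae_of_all _ fun x => ?_)
        simp only [smul_eq_mul]
        field_simp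
    _ = v * ∫ x, p' x * gaussianPDFReal 0 v x := by rw [h]; ring
    _ = _ := by simp only [smul_eq_mul, mul_comm]

lemma memLp_hermiteVar_gaussianReal (α x : ℝ) (v : ℝ≥0) (k : ℕ) (p : ℝ≥0∞) (hp : p ≠ ∞) :
    MemLp (fun z => hermiteVar α k (x + z)) p (gaussianReal 0 v) :=
  memLp_hermiteVar_comp (fun p hp => (memLp_const x).add (memLp_id_gaussianReal' p hp)) α k p hp

lemma integrable_of_forall_memLp {Ω : Type*} [MeasurableSpace Ω] {P : Measure Ω} {X : Ω → ℝ}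
    (hX : ∀ p : ℝ≥0∞, p ≠ ∞ → MemLp X p P) : Integrable X P :=
  memLp_one_iff_integrable.1 (hX 1 (by simp))

/-- Averaging a Hermite polynomial against a centred Gaussian law lowers its variance parameter. -/
lemma integral_hermiteVar_add (α x : ℝ) (v : ℝ≥0) (k : ℕ) :
    ∫ z, hermiteVar α k (x + z) ∂gaussianReal 0 v = hermiteVar (α - v) k x := by
  induction k using Nat.strong_induction_on with
  | _ k ih =>
    rcases k with _ | k
    · simp [hermiteVar]
    have hm (j : ℕ) := memLp_hermiteVar_gaussianReal α x v j
    have hi (j : ℕ) : Integrable (fun z => hermiteVar α j (x + z)) (gaussianReal 0 v) :=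
      integrable_of_forall_memLp (hm j)
    have hz : Integrable (fun z => z * hermiteVar α k (x + z)) (gaussianReal 0 v) :=
      integrable_of_forall_memLp (memLp_mul_of_forall memLp_id_gaussianReal' (hm k))
    have hxz : Integrable (fun z => x * hermiteVar α k (x + z) + z * hermiteVar α k (x + z))
      (gaussianReal 0 v) := ((hi k).const_mul x).add hz
    have hs := integral_mul_gaussianReal (v := v)
      (p := fun z => hermiteVar α k (x + z)) (p' := fun z => k * hermiteVar α (k - 1) (x + z))
      (fun z => by simpa using (hasDerivAt_hermiteVar α k (x + z)).comp_const_add x z)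
      (hi k) ((hi (k - 1)).const_mul _) hz
    rw [integral_const_mul] at hs
    have hk : (k : ℝ) * ∫ z, hermiteVar α (k - 1) (x + z) ∂gaussianReal 0 v =
        k * hermiteVar (α - v) (k - 1) x := by
      rcases k with _ | k
      · simp
      · rw [ih (k + 1 - 1) (by omega)]
    calc ∫ z, hermiteVar α (k + 1) (x + z) ∂gaussianReal 0 v
        = ∫ z, (x * hermiteVar α k (x + z) + z * hermiteVar α k (x + z)
            - α * (k * hermiteVar α (k - 1) (x + z))) ∂gaussianReal 0 v := by
          simp only [hermiteVar_succ, add_mul]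
      -- Integration by parts contributes `v` and the recursion `-α`, which together give the
      -- recursion with parameter `α - v`. The identity is polynomial, so the sign of `α - v` plays
      -- no role.
      _ = x * hermiteVar (α - v) k x + v * (k * hermiteVar (α - v) (k - 1) x)
            - α * (k * hermiteVar (α - v) (k - 1) x) := by
          rw [integral_sub hxz (((hi (k - 1)).const_mul _).const_mul _),
            integral_add ((hi k).const_mul x) hz, hs, integral_const_mul, integral_const_mul,
            integral_const_mul, hk, ih k (by omega)]
      _ = _ := by rw [hermiteVar_succ]; ring

/-- Hermite polynomials of the same variance parameter are orthogonal. -/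
lemma integral_hermiteVar_mul_hermiteVar (v : ℝ≥0) (k l : ℕ) :
    ∫ x, hermiteVar v k x * hermiteVar v l x ∂gaussianReal 0 v =
      if k = l then (k.factorial : ℝ) * v ^ k else 0 := by
  have hm (j : ℕ) (p : ℝ≥0∞) (hp : p ≠ ∞) : MemLp (hermiteVar v j) p (gaussianReal 0 v) := by
    simpa using memLp_hermiteVar_gaussianReal v 0 v j p hp
  have hmm (i j : ℕ) := memLp_mul_of_forall (hm i) (hm j)
  -- Raising the degree is adjoint to `v` times differentiation: in the integration by parts, the
  -- term that differentiates the first factor is exactly what the recursion subtracts.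
  have hrec (k l : ℕ) : ∫ x, hermiteVar v (k + 1) x * hermiteVar v l x ∂gaussianReal 0 v =
      v * (l * ∫ x, hermiteVar v k x * hermiteVar v (l - 1) x ∂gaussianReal 0 v) := by
    have hi1 := (integrable_of_forall_memLp (hmm (k - 1) l)).const_mul (k : ℝ)
    have hi2 := (integrable_of_forall_memLp (hmm k (l - 1))).const_mul (l : ℝ)
    have hz : Integrable (fun x => x * (hermiteVar v k x * hermiteVar v l x)) (gaussianReal 0 v) :=
      integrable_of_forall_memLp (memLp_mul_of_forall memLp_id_gaussianReal' (hmm k l))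
    have hs := integral_mul_gaussianReal (v := v)
      (p := fun x => hermiteVar v k x * hermiteVar v l x)
      (p' := fun x => k * (hermiteVar v (k - 1) x * hermiteVar v l x)
        + l * (hermiteVar v k x * hermiteVar v (l - 1) x))
      (fun x => ((hasDerivAt_hermiteVar v k x).mul (hasDerivAt_hermiteVar v l x)).congr_deriv
        (by ring))
      (integrable_of_forall_memLp (hmm k l)) (hi1.add hi2) hz
    calc ∫ x, hermiteVar v (k + 1) x * hermiteVar v l x ∂gaussianReal 0 v
        = ∫ x, (x * (hermiteVar v k x * hermiteVar v l x)
          - v * (k * (hermiteVar v (k - 1) x * hermiteVar v l x))) ∂gaussianReal 0 v := by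
          refine integral_congr_ae (ae_of_all _ fun x => ?_)
          simp only [hermiteVar_succ]
          ring
      _ = _ := by
          rw [integral_sub hz (hi1.const_mul _), hs, integral_add hi1 hi2]
          simp only [integral_const_mul]
          ring
  induction k generalizing l with
  | zero =>
    rcases l with _ | l
    · simp [hermiteVar]
    · have := hrec l 0
      simp only [mul_comm (hermiteVar _ (l + 1) _)] at this
      simp [this]
  | succ k ih =>
    rw [hrec]
    rcases l with _ | l
    · simp
    · simp only [Nat.add_sub_cancel, ih, Nat.add_right_cancel_iff]
      split_ifs with h
      · subst h
        rw [Nat.factorial_succ]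
        push_cast
        ring
      · simp

end WickApprox

namespace WickApprox

variable {Ω : Type*} [MeasurableSpace Ω] {P : Measure Ω} {W : unitInterval → Ω → ℝ}

/-! ### The Wiener integral as a Gaussian process -/

lemma wienerIntegral_stepL2 (hW : IsBrownianMotion W P) (c : unitInterval →₀ ℝ) :
    wienerIntegral hW (stepL2 c) = stepIntegral hW c :=
  LinearMap.extendOfNorm_eq (f := stepIntegral hW) denseRange_stepL2
    ⟨1, fun c => by rw [norm_stepIntegral hW c, one_mul]⟩ c

lemma norm_wienerIntegral (hW : IsBrownianMotion W P) (u : Lp ℝ 2 unitMeasure) :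
    ‖wienerIntegral hW u‖ = ‖u‖ := by
  refine denseRange_stepL2.induction_on u (isClosed_eq (by fun_prop) (by fun_prop)) fun c => ?_
  rw [wienerIntegral_stepL2, norm_stepIntegral]

lemma inner_wienerIntegral (hW : IsBrownianMotion W P) (u v : Lp ℝ 2 unitMeasure) :
    inner ℝ (wienerIntegral hW u) (wienerIntegral hW v) = inner ℝ u v :=
  (⟨(wienerIntegral hW).toLinearMap, norm_wienerIntegral hW⟩ :
    Lp ℝ 2 unitMeasure →ₗᵢ[ℝ] Lp ℝ 2 P).inner_map_map u v

lemma coeFn_finsetSum {ι : Type*} (s : Finset ι) (X : ι → Lp ℝ 2 P) :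
    ⇑(∑ i ∈ s, X i) =ᵐ[P] fun ω => ∑ i ∈ s, X i ω := by
  classical
  induction s using Finset.induction_on with
  | empty => simpa using! Lp.coeFn_zero ℝ 2 P
  | insert i s hi ih =>
    rw [Finset.sum_insert hi]
    filter_upwards [Lp.coeFn_add (X i) (∑ i ∈ s, X i), ih] with ω h1 h2
    rw [h1, Pi.add_apply, h2, Finset.sum_insert hi]

lemma coeFn_stepIntegral (hW : IsBrownianMotion W P) (c : unitInterval →₀ ℝ) :
    ⇑(stepIntegral hW c) =ᵐ[P] fun ω => ∑ t ∈ c.support, c t * W t ω := by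
  rw [stepIntegral, Finsupp.linearCombination_apply, Finsupp.sum]
  have h : ∀ᵐ ω ∂P, ∀ t ∈ c.support, (c t • (hW.memLp t).toLp (W t) : Lp ℝ 2 P) ω =
      c t * W t ω := by
    refine (Finset.eventually_all c.support).2 fun t _ => ?_
    filter_upwards [Lp.coeFn_smul (c t) ((hW.memLp t).toLp (W t)), (hW.memLp t).coeFn_toLp]
      with ω h1 h2
    rw [h1, Pi.smul_apply, h2, smul_eq_mul]
  filter_upwards [coeFn_finsetSum c.support fun t => (c t • (hW.memLp t).toLp (W t) : Lp ℝ 2 P), h]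
    with ω h1 h2
  rw [h1]
  exact Finset.sum_congr rfl h2

lemma integral_sq_eq_norm_sq (X : Lp ℝ 2 P) : ∫ ω, X ω ^ 2 ∂P = ‖X‖ ^ 2 := by
  rw [← real_inner_self_eq_norm_sq, L2.inner_def]
  simp [sq]

lemma map_stepIntegral (hW : IsBrownianMotion W P) (c : unitInterval →₀ ℝ) :
    P.map (stepIntegral hW c) = gaussianReal 0 (‖stepL2 c‖ ^ 2).toNNReal := by
  have hP := hW.gaussian.isProbabilityMeasure
  have hS := coeFn_stepIntegral hW c
  have hgauss : HasGaussianLaw (stepIntegral hW c : Ω → ℝ) P := by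
    have h := (hW.gaussian.hasGaussianLaw c.support).map
      (∑ t : c.support, c t • ContinuousLinearMap.proj (R := ℝ) (φ := fun _ : c.support => ℝ) t)
    refine h.congr (EventuallyEq.trans (ae_of_all _ fun ω => ?_) hS.symm)
    simp [Finset.sum_attach c.support fun t => c t * W t ω]
  have hmean : ∫ ω, stepIntegral hW c ω ∂P = 0 := by
    rw [integral_congr_ae hS, integral_finsetSum _ fun t _ =>
      ((hW.memLp t).integrable one_le_two).const_mul _]
    simp [integral_const_mul, hW.mean]
  rw [hgauss.map_eq_gaussianReal, variance_of_integral_eq_zero hgauss.aemeasurable hmean, hmean,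
    integral_sq_eq_norm_sq, norm_stepIntegral]

/-- The Wiener integral `I(u)` is centred Gaussian with variance `‖u‖²`. -/
lemma map_wienerIntegral (hW : IsBrownianMotion W P) (u : Lp ℝ 2 unitMeasure) :
    P.map (wienerIntegral hW u) = gaussianReal 0 (‖u‖ ^ 2).toNNReal := by
  have hP := hW.gaussian.isProbabilityMeasure
  obtain ⟨x, hx, hxu⟩ := mem_closure_iff_seq_limit.1 (denseRange_stepL2 u)
  choose c hc using hx
  have hlim : Tendsto (fun n => wienerIntegral hW (x n)) atTop (𝓝 (wienerIntegral hW u)) :=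
    ((wienerIntegral hW).continuous.tendsto u).comp hxu
  have hmeas (X : Lp ℝ 2 P) : AEMeasurable X P := (Lp.aestronglyMeasurable X).aemeasurable
  have hdist := (tendstoInMeasure_of_tendsto_Lp hlim).tendstoInDistribution fun n => hmeas _
  refine Measure.ext_of_charFun (funext fun t => ?_)
  -- Convergence in `L²` implies convergence in law, so the characteristic functions of the
  -- approximating step integrals tend to that of `I(u)`; being explicit Gaussian ones, they also
  -- converge along the norms.
  refine tendsto_nhds_unique (ProbabilityMeasure.tendsto_iff_tendsto_charFun.1 hdist.tendsto t) ?_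
  have hn (n : ℕ) : P.map (wienerIntegral hW (x n)) = gaussianReal 0 (‖x n‖ ^ 2).toNNReal := by
    rw [← hc n, wienerIntegral_stepL2, map_stepIntegral]
  simp only [ProbabilityMeasure.coe_mk, hn, charFun_gaussianReal]
  refine (Complex.continuous_exp.tendsto _).comp (tendsto_const_nhds.sub ?_)
  refine Tendsto.div_const (Tendsto.mul_const _ ?_) _
  simp only [Real.coe_toNNReal _ (sq_nonneg _)]
  exact (Complex.continuous_ofReal.tendsto _).comp ((continuous_norm.pow 2).tendsto u |>.comp hxu)

lemma hasGaussianLaw_wienerIntegral (hW : IsBrownianMotion W P) (u : Lp ℝ 2 unitMeasure) :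
    HasGaussianLaw (wienerIntegral hW u : Ω → ℝ) P :=
  ⟨by rw [map_wienerIntegral]; infer_instance⟩

/-- A linear functional of finitely many integrals is the integral of a linear combination, hence
Gaussian. Joint Gaussianity is what turns orthogonality of integrands into independence. -/
lemma isGaussianProcess_wienerIntegral (hW : IsBrownianMotion W P) :
    IsGaussianProcess (fun (u : Lp ℝ 2 unitMeasure) ω => wienerIntegral hW u ω) P := by
  have hmeas (u : Lp ℝ 2 unitMeasure) : AEMeasurable (wienerIntegral hW u) P :=
    (hasGaussianLaw_wienerIntegral hW u).aemeasurable
  refine ⟨fun s => ⟨isGaussian_of_isGaussian_map fun L => ?_⟩⟩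
  have hpi : AEMeasurable (fun ω => s.restrict fun u => wienerIntegral hW u ω) P :=
    aemeasurable_pi_lambda (fun ω (u : s) => wienerIntegral hW u ω) fun u => hmeas u
  rw [AEMeasurable.map_map_of_aemeasurable (by fun_prop) hpi]
  classical
  have h : (fun ω => L (s.restrict fun u => wienerIntegral hW u ω)) =ᵐ[P]
      wienerIntegral hW (∑ u : s, L (Pi.single u 1) • (u : Lp ℝ 2 unitMeasure)) := by
    rw [map_sum]
    have h' : ∀ᵐ ω ∂P, ∀ u : s,
        (wienerIntegral hW (L (Pi.single u 1) • (u : Lp ℝ 2 unitMeasure))) ω =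
          L (Pi.single u 1) * wienerIntegral hW u ω := by
      refine (ae_all_iff).2 fun u => ?_
      rw [map_smul]
      filter_upwards [Lp.coeFn_smul (L (Pi.single u 1)) (wienerIntegral hW u)] with ω h1
      rw [h1, Pi.smul_apply, smul_eq_mul]
    filter_upwards [h', coeFn_finsetSum Finset.univ fun u : s =>
      wienerIntegral hW (L (Pi.single u 1) • (u : Lp ℝ 2 unitMeasure))] with ω h1 h2
    rw [h2, Finset.sum_congr rfl fun u _ => h1 u]
    conv_lhs => rw [← Finset.univ_sum_single (s.restrict fun u => wienerIntegral hW u ω)]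
    rw [map_sum]
    refine Finset.sum_congr rfl fun u _ => ?_
    rw [mul_comm, ← smul_eq_mul, ← map_smul, ← Pi.single_smul]
    simp
  rw [Function.comp_def, Measure.map_congr h]
  exact (hasGaussianLaw_wienerIntegral hW _).isGaussian_map

lemma integral_wienerIntegral (hW : IsBrownianMotion W P) (u : Lp ℝ 2 unitMeasure) :
    ∫ ω, wienerIntegral hW u ω ∂P = 0 := by
  have h := integral_map (hasGaussianLaw_wienerIntegral hW u).aemeasurable
    (f := id) (by fun_prop)
  rw [map_wienerIntegral] at h
  simpa using h.symm

lemma covariance_wienerIntegral (hW : IsBrownianMotion W P) (u v : Lp ℝ 2 unitMeasure) :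
    cov[fun ω => wienerIntegral hW u ω, fun ω => wienerIntegral hW v ω; P] = inner ℝ u v := by
  have hP := hW.gaussian.isProbabilityMeasure
  rw [covariance_eq_sub (Lp.memLp _) (Lp.memLp _), integral_wienerIntegral, zero_mul, sub_zero,
    ← inner_wienerIntegral hW, L2.inner_def]
  simp [mul_comm]

end WickApprox

namespace WickApprox

variable {Ω : Type*} [MeasurableSpace Ω] {P : Measure Ω} {W : unitInterval → Ω → ℝ}

/-! ### Wick powers of Wiener integrals -/

/-- Averaging a Hermite polynomial over an independent Gaussian summand. -/
lemma integral_hermiteVar_add_mul [IsProbabilityMeasure P] {X Z B : Ω → ℝ} {v : ℝ≥0}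
    (hX : AEMeasurable X P) (hB : AEMeasurable B P)
    (hZ : P.map Z = gaussianReal 0 v) (hind : IndepFun (fun ω => (X ω, B ω)) Z P) (α : ℝ) (k : ℕ)
    (hint : Integrable (fun ω => hermiteVar α k (X ω + Z ω) * B ω) P) :
    ∫ ω, hermiteVar α k (X ω + Z ω) * B ω ∂P = ∫ ω, hermiteVar (α - v) k (X ω) * B ω ∂P := by
  have hZm : AEMeasurable Z P := aemeasurable_of_map_neZero (by rw [hZ]; infer_instance)
  have hXB : AEMeasurable (fun ω => (X ω, B ω)) P := hX.prodMk hB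
  have hprob := Measure.isProbabilityMeasure_map hXB
  have hlaw := (indepFun_iff_map_prod_eq_prod_map_map hXB hZm).1 hind
  rw [hZ] at hlaw
  have hm : Measurable fun p : (ℝ × ℝ) × ℝ => hermiteVar α k (p.1.1 + p.2) * p.1.2 :=
    ((measurable_hermiteVar α k).comp (by fun_prop)).mul (by fun_prop)
  have hm' : Measurable fun p : ℝ × ℝ => hermiteVar (α - v) k p.1 * p.2 :=
    ((measurable_hermiteVar _ k).comp (by fun_prop)).mul (by fun_prop)
  have hint' : Integrable (fun p : (ℝ × ℝ) × ℝ => hermiteVar α k (p.1.1 + p.2) * p.1.2)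
      ((P.map fun ω => (X ω, B ω)).prod (gaussianReal 0 v)) := by
    rw [← hlaw]
    exact (integrable_map_measure hm.aestronglyMeasurable (hXB.prodMk hZm)).2 hint
  -- Fubini, with `Z` integrated first. The factor `B` is a passive weight: later a second Wick
  -- power, or the indicator of a conditioning event.
  calc ∫ ω, hermiteVar α k (X ω + Z ω) * B ω ∂P
      = ∫ p, hermiteVar α k (p.1.1 + p.2) * p.1.2
          ∂(P.map fun ω => (X ω, B ω)).prod (gaussianReal 0 v) := by
        rw [← hlaw, integral_map (hXB.prodMk hZm) hm.aestronglyMeasurable]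
    _ = ∫ q, hermiteVar (α - v) k q.1 * q.2 ∂P.map fun ω => (X ω, B ω) := by
        rw [integral_prod _ hint']
        simp only [integral_mul_const, integral_hermiteVar_add]
    _ = _ := integral_map hXB hm'.aestronglyMeasurable

lemma memLp_wienerIntegral (hW : IsBrownianMotion W P) (u : Lp ℝ 2 unitMeasure) (p : ℝ≥0∞)
    (hp : p ≠ ∞) : MemLp (wienerIntegral hW u) p P :=
  (hasGaussianLaw_wienerIntegral hW u).memLp hp

lemma memLp_hermiteVar_wienerIntegral (hW : IsBrownianMotion W P) (u : Lp ℝ 2 unitMeasure)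
    (α : ℝ) (k : ℕ) (p : ℝ≥0∞) (hp : p ≠ ∞) :
    MemLp (fun ω => hermiteVar α k (wienerIntegral hW u ω)) p P := by
  have := hW.gaussian.isProbabilityMeasure
  exact memLp_hermiteVar_comp (memLp_wienerIntegral hW u) α k p hp

lemma indepFun_wienerIntegral (hW : IsBrownianMotion W P) {u v : Lp ℝ 2 unitMeasure}
    (huv : inner ℝ u v = 0) : IndepFun (wienerIntegral hW u) (wienerIntegral hW v) P :=
  HasGaussianLaw.indepFun_of_covariance_eq_zero
    ((isGaussianProcess_wienerIntegral hW).hasGaussianLaw_prodMk (s := u) (t := v))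
    ((covariance_wienerIntegral hW u v).trans huv)

/-- Expectation of a product of Wick powers. -/
lemma integral_hermiteVar_wienerIntegral (hW : IsBrownianMotion W P) (u v : Lp ℝ 2 unitMeasure)
    (k l : ℕ) :
    ∫ ω, hermiteVar (‖u‖ ^ 2) k (wienerIntegral hW u ω) *
        hermiteVar (‖v‖ ^ 2) l (wienerIntegral hW v ω) ∂P =
      if k = l then (k.factorial : ℝ) * inner ℝ u v ^ k else 0 := by
  have hP := hW.gaussian.isProbabilityMeasure
  -- Split `u = c v + w` with `w ⟂ v`. Averaging out the independent `I(w)` lowers the variance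
  -- parameter to `c² ‖v‖²`, homogeneity gives `c ^ k`, and one-dimensional orthogonality finishes.
  -- If `v = 0`, division by zero makes `c = 0`, which is still correct.
  set c : ℝ := inner ℝ u v / ‖v‖ ^ 2
  have hc : c * ‖v‖ ^ 2 = inner ℝ u v := by
    rcases eq_or_ne v 0 with rfl | hv
    · simp
    · exact div_mul_cancel₀ _ (by positivity)
  set w := u - c • v with hw
  have hvw : inner ℝ v w = 0 := by
    rw [hw, inner_sub_right, real_inner_smul_right, real_inner_self_eq_norm_sq, hc,
      real_inner_comm, sub_self]
  have huw : u = c • v + w := by rw [hw]; abel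
  have hnorm : ‖u‖ ^ 2 = c ^ 2 * ‖v‖ ^ 2 + ‖w‖ ^ 2 := by
    have hcv : inner ℝ (c • v) w = 0 := by rw [real_inner_smul_left, hvw, mul_zero]
    rw [huw, sq, norm_add_sq_eq_norm_sq_add_norm_sq_real hcv, norm_smul, Real.norm_eq_abs,
      ← sq_abs c]
    ring
  have hae : ∀ᵐ ω ∂P, wienerIntegral hW u ω = c * wienerIntegral hW v ω + wienerIntegral hW w ω := by
    rw [huw, map_add, map_smul]
    filter_upwards [Lp.coeFn_add (c • wienerIntegral hW v) (wienerIntegral hW w),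
      Lp.coeFn_smul c (wienerIntegral hW v)] with ω h1 h2
    rw [h1, Pi.add_apply, h2, Pi.smul_apply, smul_eq_mul]
  have hI := integrable_of_forall_memLp (memLp_mul_of_forall
    (memLp_hermiteVar_wienerIntegral hW u (‖u‖ ^ 2) k)
    (memLp_hermiteVar_wienerIntegral hW v (‖v‖ ^ 2) l))
  have hIae : (fun ω => hermiteVar (‖u‖ ^ 2) k (wienerIntegral hW u ω) *
        hermiteVar (‖v‖ ^ 2) l (wienerIntegral hW v ω)) =ᵐ[P]
      fun ω => hermiteVar (‖u‖ ^ 2) k (c * wienerIntegral hW v ω + wienerIntegral hW w ω) *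
        hermiteVar (‖v‖ ^ 2) l (wienerIntegral hW v ω) := by
    filter_upwards [hae] with ω h
    rw [h]
  have hvm := (hasGaussianLaw_wienerIntegral hW v).aemeasurable
  have hvh : AEMeasurable (fun ω => hermiteVar (‖v‖ ^ 2) l (wienerIntegral hW v ω)) P :=
    (measurable_hermiteVar _ l).comp_aemeasurable hvm
  have hind : IndepFun (fun ω => (c * wienerIntegral hW v ω,
      hermiteVar (‖v‖ ^ 2) l (wienerIntegral hW v ω))) (wienerIntegral hW w) P :=
    (indepFun_wienerIntegral hW hvw).comp
      (φ := fun x => (c * x, hermiteVar (‖v‖ ^ 2) l x)) (ψ := id)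
      ((measurable_const_mul c).prodMk (measurable_hermiteVar _ l)) measurable_id
  rw [integral_congr_ae hIae, integral_hermiteVar_add_mul (hvm.const_mul c)
    hvh (map_wienerIntegral hW w) hind _ _
    (hI.congr hIae), Real.coe_toNNReal _ (sq_nonneg _), hnorm, add_sub_cancel_right]
  simp only [hermiteVar_mul, mul_assoc]
  rw [integral_const_mul]
  have hlaw := integral_map hvm (f := fun x => hermiteVar (‖v‖ ^ 2) k x * hermiteVar (‖v‖ ^ 2) l x)
    ((measurable_hermiteVar _ k).mul (measurable_hermiteVar _ l)).aestronglyMeasurable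
  have horth := integral_hermiteVar_mul_hermiteVar (‖v‖ ^ 2).toNNReal k l
  rw [Real.coe_toNNReal _ (sq_nonneg _)] at horth
  rw [← hlaw, map_wienerIntegral, horth, ← hc, mul_pow]
  split_ifs <;> ring

/-- The Wick power `I(u)^{⋄k}` as an element of `L²(Ω)`. -/
noncomputable def wickPower (hW : IsBrownianMotion W P) (k : ℕ) (u : Lp ℝ 2 unitMeasure) : Lp ℝ 2 P :=
  (memLp_hermiteVar_wienerIntegral hW u (‖u‖ ^ 2) k 2 (by simp)).toLp _

lemma coeFn_wickPower (hW : IsBrownianMotion W P) (k : ℕ) (u : Lp ℝ 2 unitMeasure) :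
    wickPower hW k u =ᵐ[P] fun ω => hermiteVar (‖u‖ ^ 2) k (wienerIntegral hW u ω) :=
  MemLp.coeFn_toLp _

lemma inner_wickPower (hW : IsBrownianMotion W P) (u v : Lp ℝ 2 unitMeasure) (k l : ℕ) :
    inner ℝ (wickPower hW k u) (wickPower hW l v) =
      if k = l then (k.factorial : ℝ) * inner ℝ u v ^ k else 0 := by
  rw [← integral_hermiteVar_wienerIntegral hW, L2.inner_def]
  refine integral_congr_ae ?_
  filter_upwards [coeFn_wickPower hW k u, coeFn_wickPower hW l v] with ω h1 h2
  simp [h1, h2, mul_comm]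

lemma norm_wickPower (hW : IsBrownianMotion W P) (u : Lp ℝ 2 unitMeasure) (k : ℕ) :
    ‖wickPower hW k u‖ = √(k.factorial) * ‖u‖ ^ k := by
  rw [@norm_eq_sqrt_real_inner, inner_wickPower, if_pos rfl, real_inner_self_eq_norm_sq,
    ← pow_mul, mul_comm 2 k, pow_mul, Real.sqrt_mul (by positivity), Real.sqrt_sq (by positivity)]

/-! ### Wick series in `L²(Ω)` -/

/-- Coefficients bounded by `C^(k+1) / k!`. -/
def HasFactorialDecay (a : ℕ → ℝ) (C : ℝ) : Prop :=
  1 ≤ C ∧ ∀ k, (k.factorial : ℝ) * |a k| ≤ C ^ (k + 1)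

lemma IsWickAnalytic.exists_hasFactorialDecay {a : ℕ → ℝ} (ha : IsWickAnalytic a) :
    ∃ C, HasFactorialDecay a C := by
  obtain ⟨C, hC⟩ := ha
  -- The growth condition says nothing about `a 0`, so `|a 0|` is included; the exponent `k + 1`
  -- leaves room for it at `k = 0`.
  set E : ℝ := max (max C |a 0|) 1
  have hE1 : 1 ≤ E := le_max_right _ _
  refine ⟨E, hE1, fun k => ?_⟩
  rcases Nat.eq_zero_or_pos k with rfl | hk
  · have h0 : |a 0| ≤ E := (le_max_right C |a 0|).trans (le_max_left _ 1)
    simpa using h0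
  · have hCE : C ≤ E := (le_max_left C |a 0|).trans (le_max_left _ 1)
    have h := (hC ⟨k, hk, rfl⟩).trans hCE
    have hnn : 0 ≤ (k.factorial : ℝ) * |a k| := by positivity
    have h' := pow_le_pow_left₀ (Real.rpow_nonneg hnn _) h k
    rw [one_div, Real.rpow_inv_natCast_pow hnn (by omega)] at h'
    exact h'.trans (pow_le_pow_right₀ hE1 (Nat.le_succ k))

namespace HasFactorialDecay

variable {a b : ℕ → ℝ} {C D : ℝ}

/-- These are the coefficients of the derivative, since `h^k` differentiates to `k h^(k-1)`. The
constant `C ^ 2` suffices because `k + 2 ≤ 2 (k + 1)` and `1 ≤ C`. -/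
lemma shift (ha : HasFactorialDecay a C) :
    HasFactorialDecay (fun k => (k + 1) * a (k + 1)) (C ^ 2) := by
  refine ⟨one_le_pow₀ ha.1, fun k => ?_⟩
  rw [abs_mul, abs_of_nonneg (by positivity : (0 : ℝ) ≤ k + 1)]
  calc (k.factorial : ℝ) * ((k + 1) * |a (k + 1)|) = ((k + 1).factorial : ℝ) * |a (k + 1)| := by
        rw [Nat.factorial_succ]; push_cast; ring
    _ ≤ C ^ (k + 1 + 1) := ha.2 (k + 1)
    _ ≤ C ^ (2 * (k + 1)) := pow_le_pow_right₀ ha.1 (by omega)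
    _ = _ := pow_mul _ _ _

lemma of_abs_le (ha : HasFactorialDecay a C) (hb : ∀ k, |b k| ≤ |a k|) :
    HasFactorialDecay b C :=
  ⟨ha.1, fun k => (mul_le_mul_of_nonneg_left (hb k) (by positivity)).trans (ha.2 k)⟩

lemma abs_le (ha : HasFactorialDecay a C) (k : ℕ) : |a k| ≤ C ^ (k + 1) / k.factorial := by
  rw [le_div_iff₀ (by positivity), mul_comm]
  exact ha.2 k

/-- The weight `√(k!) R ^ k` is both the `L²` norm of a Wick power and the pointwise bound on
Hermite polynomials, so this yields convergence in both senses. -/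
lemma summable_mul_sqrt_factorial (ha : HasFactorialDecay a C) {R : ℝ} (hR : 0 ≤ R) :
    Summable fun k => |a k| * (√(k.factorial) * R ^ k) := by
  have hC : 0 ≤ C := zero_le_one.trans ha.1
  have hmaj : Summable fun k : ℕ =>
      C * ((2 * (C * R) ^ 2) ^ k / (k.factorial : ℝ) + (1 / 2 : ℝ) ^ k) :=
    ((Real.summable_pow_div_factorial _).add
      (summable_geometric_of_lt_one (by norm_num) (by norm_num))).mul_left C
  refine Summable.of_nonneg_of_le (fun k => by positivity) (fun k => ?_) hmaj
  have hf : (0 : ℝ) < k.factorial := by positivity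
  have hsq : √(k.factorial : ℝ) ^ 2 = k.factorial := Real.sq_sqrt hf.le
  have hs : 0 < √(k.factorial : ℝ) := Real.sqrt_pos.2 hf
  set u : ℝ := (C * R) ^ k / √(k.factorial : ℝ) with hu
  have hu1 : C ^ (k + 1) / k.factorial * (√(k.factorial : ℝ) * R ^ k) = C * u := by
    rw [hu, mul_pow, div_mul_eq_mul_div, mul_div_assoc', div_eq_div_iff hf.ne' hs.ne']
    linear_combination C * C ^ k * R ^ k * hsq
  have hu2 : (2 * (C * R) ^ 2) ^ k / (k.factorial : ℝ) = u ^ 2 * 2 ^ k := by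
    rw [hu, div_pow, hsq, mul_pow, ← pow_mul, ← pow_mul]; ring
  have hu0 : 0 ≤ u := by positivity
  calc |a k| * (√(k.factorial) * R ^ k)
      ≤ C ^ (k + 1) / k.factorial * (√(k.factorial : ℝ) * R ^ k) :=
        mul_le_mul_of_nonneg_right (ha.abs_le k) (by positivity)
    _ = C * u := hu1
    -- Squaring `u` replaces `√(k!)` by `k!`, which leaves an exponential series plus a geometric
    -- one.
    _ ≤ C * (u ^ 2 * 2 ^ k + 1 / 2 ^ k) := by
      refine mul_le_mul_of_nonneg_left ?_ hC
      rw [← sub_nonneg]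
      have : u ^ 2 * 2 ^ k + 1 / 2 ^ k - u = ((u * 2 ^ k - 1) ^ 2 + u * 2 ^ k) / 2 ^ k := by
        field_simp; ring
      rw [this]; positivity
    _ = _ := by rw [hu2, one_div_pow]

lemma summable_hermiteVar (ha : HasFactorialDecay a C) (α x : ℝ) :
    Summable fun k => a k * hermiteVar α k x := by
  refine Summable.of_norm_bounded
    (ha.summable_mul_sqrt_factorial (R := 1 + |x| + |α|) (by positivity)) fun k => ?_
  rw [Real.norm_eq_abs, abs_mul]
  exact mul_le_mul_of_nonneg_left (abs_hermiteVar_le α x le_rfl k) (abs_nonneg _)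

lemma summable_norm_wickPower (ha : HasFactorialDecay a C) (hW : IsBrownianMotion W P)
    (u : Lp ℝ 2 unitMeasure) : Summable fun k => ‖a k • wickPower hW k u‖ := by
  simpa only [norm_smul, norm_wickPower, Real.norm_eq_abs] using
    ha.summable_mul_sqrt_factorial (norm_nonneg u)

/-- Termwise differentiation of a Wick series. -/
lemma hasDerivAt_wickSeries (ha : HasFactorialDecay a C) (α x : ℝ) :
    HasDerivAt (wickSeries a α) (wickSeries (fun k => (k + 1) * a (k + 1)) α x) x := by
  -- `R` controls the Hermite polynomials uniformly on the unit ball around `x`, as termwise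
  -- differentiation requires.
  set R : ℝ := 1 + (|x| + 1) + |α|
  have hR : 0 ≤ R := by positivity
  have hsum : Summable fun k : ℕ => |a k| * (k * (√((k - 1).factorial) * R ^ (k - 1))) := by
    refine (summable_nat_add_iff 1).1 ((ha.shift.summable_mul_sqrt_factorial hR).congr fun k => ?_)
    rw [abs_mul, abs_of_nonneg (by positivity : (0 : ℝ) ≤ k + 1)]
    simp only [Nat.add_sub_cancel]
    push_cast
    ring
  have hx : x ∈ Metric.ball x 1 := Metric.mem_ball_self one_pos
  have h := hasDerivAt_tsum_of_isPreconnected (g := fun k y => a k * hermiteVar α k y)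
    (g' := fun k y => a k * (k * hermiteVar α (k - 1) y)) hsum Metric.isOpen_ball
    (convex_ball x 1).isPreconnected
    (fun k y _ => (hasDerivAt_hermiteVar α k y).const_mul (a k)) (fun k y hy => ?_) hx
    (ha.summable_hermiteVar α x) hx
  · refine h.congr_deriv ?_
    have hs : Summable fun k : ℕ => a k * (k * hermiteVar α (k - 1) x) := by
      refine (summable_nat_add_iff 1).1 ((ha.shift.summable_hermiteVar α x).congr fun k => ?_)
      simp only [Nat.add_sub_cancel]
      push_cast
      ring
    rw [hs.tsum_eq_zero_add, wickSeries]
    simp only [CharP.cast_eq_zero, zero_mul, mul_zero, zero_add, Nat.add_sub_cancel]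
    refine tsum_congr fun k => ?_
    push_cast
    ring
  · rw [Real.norm_eq_abs, abs_mul, abs_mul, Nat.abs_cast]
    have hyR : 1 + |y| + |α| ≤ R := by
      have h1 : |y - x| < 1 := by simpa [Real.dist_eq] using hy
      have h2 : |y| ≤ |x| + 1 := by
        have := abs_sub_abs_le_abs_sub y x
        linarith
      simp only [R]
      linarith
    gcongr
    exact abs_hermiteVar_le α y hyR (k - 1)

end HasFactorialDecay

/-- The Wick series `∑_k a_k I(u)^{⋄k}` in `L²(Ω)`. -/
noncomputable def wickVector (hW : IsBrownianMotion W P) (a : ℕ → ℝ) (u : Lp ℝ 2 unitMeasure) :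
    Lp ℝ 2 P :=
  ∑' k, a k • wickPower hW k u

lemma HasFactorialDecay.hasSum_wickVector {a : ℕ → ℝ} {C : ℝ} (ha : HasFactorialDecay a C)
    (hW : IsBrownianMotion W P) (u : Lp ℝ 2 unitMeasure) :
    HasSum (fun k => a k • wickPower hW k u) (wickVector hW a u) :=
  (ha.summable_norm_wickPower hW u).of_norm.hasSum

/-- A limit in `L²` of partial sums agrees almost everywhere with the pointwise sum. -/
lemma ae_eq_of_hasSum {x : ℕ → Lp ℝ 2 P} {X : Lp ℝ 2 P} (hX : HasSum x X) {ξ : ℕ → Ω → ℝ}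
    {Ξ : Ω → ℝ} (hξ : ∀ k, x k =ᵐ[P] ξ k) (hΞ : ∀ᵐ ω ∂P, HasSum (fun k => ξ k ω) (Ξ ω)) :
    X =ᵐ[P] Ξ := by
  -- Almost sure convergence along a subsequence is enough to identify the limit, since the full
  -- pointwise series is known to converge.
  obtain ⟨ns, hns, hlim⟩ := (tendstoInMeasure_of_tendsto_Lp hX.tendsto_sum_nat).exists_seq_tendsto_ae
  have hall : ∀ᵐ ω ∂P, ∀ n, (∑ k ∈ Finset.range n, x k : Lp ℝ 2 P) ω =
      ∑ k ∈ Finset.range n, ξ k ω := by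
    refine ae_all_iff.2 fun n => ?_
    filter_upwards [coeFn_finsetSum (Finset.range n) x, ae_all_iff.2 hξ] with ω h1 h2
    rw [h1]
    exact Finset.sum_congr rfl fun k _ => h2 k
  filter_upwards [hlim, hall, hΞ] with ω h1 h2 h3
  refine tendsto_nhds_unique h1 ?_
  simp only [h2]
  exact h3.tendsto_sum_nat.comp hns.tendsto_atTop

lemma HasFactorialDecay.coeFn_wickVector {a : ℕ → ℝ} {C : ℝ} (ha : HasFactorialDecay a C)
    (hW : IsBrownianMotion W P) (u : Lp ℝ 2 unitMeasure) :
    wickVector hW a u =ᵐ[P] fun ω => wickSeries a (‖u‖ ^ 2) (wienerIntegral hW u ω) := by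
  refine ae_eq_of_hasSum (ha.hasSum_wickVector hW u)
    (ξ := fun k ω => a k * hermiteVar (‖u‖ ^ 2) k (wienerIntegral hW u ω)) (fun k => ?_)
    (ae_of_all _ fun ω => (ha.summable_hermiteVar _ _).hasSum)
  filter_upwards [Lp.coeFn_smul (a k) (wickPower hW k u), coeFn_wickPower hW k u] with ω h1 h2
  rw [h1, Pi.smul_apply, h2, smul_eq_mul]

/-- The power series `∑_k a_k b_k k! z^k`. -/
noncomputable def wickPairing (a b : ℕ → ℝ) (z : ℝ) : ℝ :=
  ∑' k, a k * b k * k.factorial * z ^ k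

/-- Different degrees are orthogonal, so only the diagonal terms survive. All later asymptotics
concern the scalar function `wickPairing a b` at inner products of integrands. -/
lemma inner_wickVector (hW : IsBrownianMotion W P) {a b : ℕ → ℝ} {C D : ℝ}
    (ha : HasFactorialDecay a C) (hb : HasFactorialDecay b D) (u v : Lp ℝ 2 unitMeasure) :
    inner ℝ (wickVector hW a u) (wickVector hW b v) = wickPairing a b (inner ℝ u v) := by
  have h1 (k : ℕ) : inner ℝ (wickPower hW k u) (wickVector hW b v) =
      b k * k.factorial * inner ℝ u v ^ k := by
    have h := ((hb.hasSum_wickVector hW v).mapL (innerSL ℝ (wickPower hW k u))).tsum_eq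
    simp only [innerSL_apply_apply] at h
    rw [← h, tsum_eq_single k fun l hl => ?_]
    · rw [real_inner_smul_right, inner_wickPower, if_pos rfl]; ring
    · rw [real_inner_smul_right, inner_wickPower, if_neg hl.symm, mul_zero]
  have h := ((ha.hasSum_wickVector hW u).mapL (innerSL ℝ (wickVector hW b v))).tsum_eq
  simp only [innerSL_apply_apply] at h
  rw [real_inner_comm, ← h, wickPairing]
  refine tsum_congr fun k => ?_
  rw [real_inner_smul_right, real_inner_comm, h1]
  ring

end WickApprox

namespace WickApprox

lemma measurable_gridValue {Ω : Type*} {W : unitInterval → Ω → ℝ} {n i : ℕ} (hi : i ∈ Finset.Icc 1 n) :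
    Measurable[gridSigma W n] (gridValue W n i) :=
  Measurable.of_comap_le (le_iSup₂_of_le i hi le_rfl)

variable {Ω : Type*} [MeasurableSpace Ω] {P : Measure Ω} {W : unitInterval → Ω → ℝ}

/-! ### Conditioning on the grid values -/

/-- The grid point `i / n` of `[0,1]`. -/
noncomputable def gridPoint (n i : ℕ) : unitInterval := projIcc (0 : ℝ) 1 zero_le_one ((i : ℝ) / n)

/-- The step functions on the grid `1/n, …, 1`. -/
noncomputable def gridSubspace (n : ℕ) : Submodule ℝ (Lp ℝ 2 unitMeasure) :=
  Submodule.span ℝ ((fun i => indicatorL2 (gridPoint n i)) '' (Finset.Icc 1 n : Set ℕ))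

instance (n : ℕ) : FiniteDimensional ℝ (gridSubspace n) :=
  FiniteDimensional.span_of_finite ℝ ((Finset.finite_toSet _).image _)

lemma indicatorL2_mem_gridSubspace {n i : ℕ} (hi : i ∈ Finset.Icc 1 n) :
    indicatorL2 (gridPoint n i) ∈ gridSubspace n :=
  Submodule.subset_span (mem_image_of_mem _ (Finset.mem_coe.2 hi))

lemma gridSigma_le (hW : IsBrownianMotion W P) (n : ℕ) :
    gridSigma W n ≤ ‹MeasurableSpace Ω› :=
  iSup₂_le fun _ _ => (hW.measurable _).comap_le

lemma wienerIntegral_gridPoint (hW : IsBrownianMotion W P) (n i : ℕ) :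
    wienerIntegral hW (indicatorL2 (gridPoint n i)) =ᵐ[P] gridValue W n i := by
  rw [wienerIntegral_indicatorL2]
  exact MemLp.coeFn_toLp _

/-- The integrands with grid-measurable integral form a subspace that contains the generating
indicators. -/
lemma aestronglyMeasurable_wienerIntegral (hW : IsBrownianMotion W P) {n : ℕ}
    {u : Lp ℝ 2 unitMeasure} (hu : u ∈ gridSubspace n) :
    AEStronglyMeasurable[gridSigma W n] (wienerIntegral hW u) P := by
  have h : gridSubspace n ≤ (lpMeas ℝ ℝ (gridSigma W n) 2 P).comap
      (wienerIntegral hW).toLinearMap := by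
    refine Submodule.span_le.2 fun v hv => ?_
    obtain ⟨i, hi, rfl⟩ := hv
    refine (mem_lpMeas_iff_aestronglyMeasurable (𝕜 := ℝ)).2 ?_
    exact ⟨gridValue W n i, (measurable_gridValue (Finset.mem_coe.1 hi)).stronglyMeasurable,
      wienerIntegral_gridPoint hW n i⟩
  exact (mem_lpMeas_iff_aestronglyMeasurable (𝕜 := ℝ)).1 (h hu)

/-- `I(w)` is uncorrelated with each grid value and jointly Gaussian with all of them, hence
independent of the whole family. -/
lemma indep_gridSigma (hW : IsBrownianMotion W P) {n : ℕ} {w : Lp ℝ 2 unitMeasure}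
    (hw : w ∈ (gridSubspace n)ᗮ) :
    Indep (gridSigma W n) (MeasurableSpace.comap (wienerIntegral hW w) inferInstance) P := by
  have hproc : IsGaussianProcess (Sum.elim (fun i : Finset.Icc 1 n => gridValue W n i)
      fun (_ : Unit) ω => wienerIntegral hW w ω) P := by
    refine ((isGaussianProcess_wienerIntegral hW).comp_right
      (Sum.elim (fun i : Finset.Icc 1 n => indicatorL2 (gridPoint n i)) fun _ : Unit => w)).congr ?_
    rintro (i | _)
    · exact wienerIntegral_gridPoint hW n i
    · exact EventuallyEq.rfl
  have hind := hproc.indepFun_of_covariance_eq_zero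
    (fun i => (hW.measurable _).aemeasurable)
    (fun _ => (hasGaussianLaw_wienerIntegral hW w).aemeasurable) fun i _ => by
      have h1 := wienerIntegral_gridPoint hW n i
      have h2 : cov[gridValue W n i, fun ω => wienerIntegral hW w ω; P] =
          cov[fun ω => wienerIntegral hW (indicatorL2 (gridPoint n i)) ω,
            fun ω => wienerIntegral hW w ω; P] := by
        rw [covariance, covariance, integral_congr_ae h1]
        refine integral_congr_ae ?_
        filter_upwards [h1] with ω h
        rw [h]
      rw [h2, covariance_wienerIntegral]
      exact hw _ (indicatorL2_mem_gridSubspace i.2)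
  have h := hind.comp (φ := id) (ψ := fun x : Unit → ℝ => x ()) measurable_id
    (measurable_pi_apply (X := fun _ : Unit => ℝ) ())
  refine indep_of_indep_of_le_left ((IndepFun_iff_Indep _ _ _).1 h) (iSup₂_le fun i hi => ?_)
  rw [Function.id_comp]
  exact ((measurable_pi_apply (X := fun _ : Finset.Icc 1 n => ℝ) ⟨i, hi⟩).comp
    (comap_measurable fun ω (i : Finset.Icc 1 n) => gridValue W n i ω)).comap_le

/-- The component of `u` orthogonal to the grid functions has an integral independent of the grid.
Averaging it out lowers the variance parameter by its squared norm, which by Pythagoras leaves that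
of the projection: Wick powers go to Wick powers. -/
lemma condExp_hermiteVar (hW : IsBrownianMotion W P) (n k : ℕ) (u : Lp ℝ 2 unitMeasure) :
    (fun ω => hermiteVar (‖(gridSubspace n).starProjection u‖ ^ 2) k
        (wienerIntegral hW ((gridSubspace n).starProjection u) ω)) =ᵐ[P]
      P[fun ω => hermiteVar (‖u‖ ^ 2) k (wienerIntegral hW u ω) | gridSigma W n] := by
  have hP := hW.gaussian.isProbabilityMeasure
  set u' := (gridSubspace n).starProjection u
  have hmem : u' ∈ gridSubspace n := Submodule.starProjection_apply_mem _ u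
  set w := u - u' with hw
  have hwperp : w ∈ (gridSubspace n)ᗮ := Submodule.sub_starProjection_mem_orthogonal u
  have huw : u = u' + w := by rw [hw]; abel
  have hnorm : ‖u‖ ^ 2 - ‖w‖ ^ 2 = ‖u'‖ ^ 2 := by
    rw [sq, sq, sq, sub_eq_iff_eq_add, ← norm_add_sq_eq_norm_sq_add_norm_sq_real (hwperp _ hmem),
      ← huw]
  have hae : ∀ᵐ ω ∂P, wienerIntegral hW u ω = wienerIntegral hW u' ω + wienerIntegral hW w ω := by
    conv in wienerIntegral hW u _ => rw [huw, map_add]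
    filter_upwards [Lp.coeFn_add (wienerIntegral hW u') (wienerIntegral hW w)] with ω h1
    rw [h1, Pi.add_apply]
  have hum := (hasGaussianLaw_wienerIntegral hW u').aemeasurable
  -- `I(u')` is only almost everywhere equal to a grid-measurable function; independence is applied
  -- to the measurable version `Y`.
  obtain ⟨Y, hYm, hY⟩ := aestronglyMeasurable_wienerIntegral hW hmem
  have hle := gridSigma_le hW n
  have hIu (v : Lp ℝ 2 unitMeasure) :
      Integrable (fun ω => hermiteVar (‖v‖ ^ 2) k (wienerIntegral hW v ω)) P :=
    integrable_of_forall_memLp (memLp_hermiteVar_wienerIntegral hW v _ k)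
  refine ae_eq_condExp_of_forall_setIntegral_eq hle (hIu u) (fun s _ _ => (hIu u').integrableOn)
    (fun s hs _ => ?_) ?_
  · have hind : IndepFun (fun ω => (Y ω, s.indicator (fun _ => (1 : ℝ)) ω))
        (wienerIntegral hW w) P := by
      refine (IndepFun_iff_Indep _ _ _).2
        (indep_of_indep_of_le_left (indep_gridSigma hW hwperp) ?_)
      exact (hYm.measurable.prodMk (measurable_const.indicator hs)).comap_le
    have hmul (φ : Ω → ℝ) :
        ∫ ω in s, φ ω ∂P = ∫ ω, φ ω * s.indicator (fun _ => (1 : ℝ)) ω ∂P := by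
      rw [← integral_indicator (hle s hs)]
      refine integral_congr_ae (ae_of_all _ fun ω => ?_)
      by_cases hω : ω ∈ s <;> simp [hω]
    have hae' : (fun ω => hermiteVar (‖u‖ ^ 2) k (wienerIntegral hW u ω) *
          s.indicator (fun _ => (1 : ℝ)) ω) =ᵐ[P]
        fun ω => hermiteVar (‖u‖ ^ 2) k (Y ω + wienerIntegral hW w ω) *
          s.indicator (fun _ => (1 : ℝ)) ω := by
      filter_upwards [hae, hY] with ω h1 h2
      rw [h1, h2]
    have hint : Integrable (fun ω => hermiteVar (‖u‖ ^ 2) k (wienerIntegral hW u ω) *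
        s.indicator (fun _ => (1 : ℝ)) ω) P := by
      refine ((hIu u).indicator (hle s hs)).congr (ae_of_all _ fun ω => ?_)
      by_cases hω : ω ∈ s <;> simp [hω]
    have h := integral_hermiteVar_add_mul (hYm.measurable.mono hle le_rfl).aemeasurable
      (measurable_const.indicator (hle s hs)).aemeasurable (map_wienerIntegral hW w) hind
      (‖u‖ ^ 2) k (hint.congr hae')
    rw [hmul, hmul, integral_congr_ae hae', h, Real.coe_toNNReal _ (sq_nonneg _), hnorm]
    refine integral_congr_ae ?_
    filter_upwards [hY] with ω h2
    rw [h2]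
  · refine ⟨fun ω => hermiteVar (‖u'‖ ^ 2) k (Y ω),
      ((measurable_hermiteVar _ k).comp hYm.measurable).stronglyMeasurable, ?_⟩
    filter_upwards [hY] with ω h2
    rw [h2]

/-- Conditioning a Wick series on the grid values projects its integrand. -/
lemma condExp_wickVector (hW : IsBrownianMotion W P) {a : ℕ → ℝ} {C : ℝ}
    (ha : HasFactorialDecay a C) (n : ℕ) (u : Lp ℝ 2 unitMeasure) {F : Ω → ℝ}
    (hF : F =ᵐ[P] wickVector hW a u) :
    P[F | gridSigma W n] =ᵐ[P] wickVector hW a ((gridSubspace n).starProjection u) := by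
  have hP := hW.gaussian.isProbabilityMeasure
  have hle := gridSigma_le hW n
  have hpow (k : ℕ) : (condExpL2 ℝ ℝ hle (wickPower hW k u) : Lp ℝ 2 P) =
      wickPower hW k ((gridSubspace n).starProjection u) := by
    refine Lp.ext ?_
    have h1 := (memLp_hermiteVar_wienerIntegral hW u (‖u‖ ^ 2) k 2 (by simp)).condExpL2_ae_eq_condExp
      (𝕜 := ℝ) hle
    exact h1.trans ((condExp_hermiteVar hW n k u).symm.trans (coeFn_wickPower hW k _).symm)
  -- Conditional expectation is continuous on `L²`, so it acts on the series term by term.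
  have hsum := (ha.hasSum_wickVector hW u).mapL
    ((lpMeas ℝ ℝ (gridSigma W n) 2 P).subtypeL ∘L condExpL2 ℝ ℝ hle)
  have hvec : (condExpL2 ℝ ℝ hle (wickVector hW a u) : Lp ℝ 2 P) =
      wickVector hW a ((gridSubspace n).starProjection u) := by
    refine hsum.unique ?_
    convert! ha.hasSum_wickVector hW ((gridSubspace n).starProjection u) using 2 with k
    rw [map_smul, ← hpow k]
    rfl
  have h2 := (Lp.memLp (wickVector hW a u)).condExpL2_ae_eq_condExp (𝕜 := ℝ) hle
  rw [Lp.toLp_coeFn, hvec] at h2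
  exact (condExp_congr_ae hF).trans h2.symm

end WickApprox

namespace WickApprox

/-! ### Integrands with a derivative of bounded variation -/

/-- `φ` is the variation function. Its increments over the grid cells telescope, and this controls
the total oscillation of `q` across cells. -/
lemma exists_monotoneOn_abs_sub_le {q : ℝ → ℝ} (hq : BoundedVariationOn q (Icc 0 1)) :
    ∃ φ : ℝ → ℝ, MonotoneOn φ (Icc 0 1) ∧
      ∀ r ∈ Icc (0 : ℝ) 1, ∀ s ∈ Icc (0 : ℝ) 1, r ≤ s → |q s - q r| ≤ φ s - φ r :=
  have h0 : (0 : ℝ) ∈ Icc (0 : ℝ) 1 := ⟨le_rfl, zero_le_one⟩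
  ⟨variationOnFromTo q (Icc 0 1) 0,
    variationOnFromTo.monotoneOn hq.locallyBoundedVariationOn h0, fun _ hr _ hs hrs =>
      variationOnFromTo.abs_sub_le_sub_of_le hq.locallyBoundedVariationOn h0 hr hs hrs⟩

lemma exists_abs_le_of_boundedVariationOn {q : ℝ → ℝ} (hq : BoundedVariationOn q (Icc 0 1)) :
    ∃ M, 0 ≤ M ∧ ∀ s ∈ Icc (0 : ℝ) 1, |q s| ≤ M := by
  obtain ⟨φ, hφ, h⟩ := exists_monotoneOn_abs_sub_le hq
  have h0 : (0 : ℝ) ∈ Icc (0 : ℝ) 1 := ⟨le_rfl, zero_le_one⟩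
  have h1 : (1 : ℝ) ∈ Icc (0 : ℝ) 1 := ⟨zero_le_one, le_rfl⟩
  have hnn := hφ h0 h1 zero_le_one
  refine ⟨|q 0| + (φ 1 - φ 0), add_nonneg (abs_nonneg _) (by linarith), fun s hs => ?_⟩
  have h2 := h 0 h0 s hs hs.1
  have h3 := hφ hs h1 hs.2
  have h4 := abs_sub_abs_le_abs_sub (q s) (q 0)
  linarith

lemma intervalIntegrable_of_boundedVariationOn {q : ℝ → ℝ} (hq : BoundedVariationOn q (Icc 0 1)) :
    IntervalIntegrable q volume 0 1 := by
  obtain ⟨φ, ψ, hφ, hψ, h⟩ := hq.locallyBoundedVariationOn.exists_monotoneOn_sub_monotoneOn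
  rw [← uIcc_of_le zero_le_one] at hφ hψ
  have := hφ.intervalIntegrable.sub hψ.intervalIntegrable (μ := volume)
  rw [h]
  exact this

lemma grid_mem_Icc {n k : ℕ} (hk : k ≤ n) : (k : ℝ) / n ∈ Icc (0 : ℝ) 1 :=
  ⟨by positivity, div_le_one_of_le₀ (by exact_mod_cast hk) (by positivity)⟩

lemma cell_subset {n k : ℕ} (hk : k < n) :
    Icc ((k : ℝ) / n) ((k + 1 : ℕ) / n) ⊆ Icc (0 : ℝ) 1 :=
  Icc_subset_Icc (grid_mem_Icc hk.le).1 (grid_mem_Icc (Nat.succ_le_of_lt hk)).2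

lemma grid_le_succ (n k : ℕ) : (k : ℝ) / n ≤ (k + 1 : ℕ) / n := by
  gcongr; exact Nat.le_succ k

lemma integral_eq_sum_cells {n : ℕ} (hn : 0 < n) {q : ℝ → ℝ} (hq : IntervalIntegrable q volume 0 1) :
    ∫ s in (0 : ℝ)..1, q s =
      ∑ k ∈ Finset.range n, ∫ s in ((k : ℝ) / n)..((k + 1 : ℕ) / n), q s := by
  rw [intervalIntegral.sum_integral_adjacent_intervals (a := fun k : ℕ => (k : ℝ) / n)
    fun k hk => ?_]
  · have : (n : ℝ) ≠ 0 := by positivity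
    simp [div_self this]
  · refine hq.mono_set ?_
    rw [uIcc_of_le (grid_le_succ n k), uIcc_of_le zero_le_one]
    exact cell_subset hk

lemma cell_length {n : ℕ} (k : ℕ) : ((k + 1 : ℕ) : ℝ) / n - k / n = 1 / n := by
  push_cast; ring

lemma sum_cell_increments {n : ℕ} (hn : 0 < n) (φ : ℝ → ℝ) :
    ∑ k ∈ Finset.range n, (φ ((k + 1 : ℕ) / n) - φ ((k : ℝ) / n)) = φ 1 - φ 0 := by
  rw [Finset.sum_range_sub fun k : ℕ => φ ((k : ℝ) / n)]
  have : (n : ℝ) ≠ 0 := by positivity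
  simp [div_self this]

/-- Riemann sums of a function of bounded variation. -/
lemma tendsto_riemannSum {q : ℝ → ℝ} (hq : BoundedVariationOn q (Icc 0 1)) :
    Tendsto (fun n : ℕ => 1 / (n : ℝ) * ∑ k ∈ Finset.range n, q ((k : ℝ) / n)) atTop
      (𝓝 (∫ s in (0 : ℝ)..1, q s)) := by
  obtain ⟨φ, hφ, h⟩ := exists_monotoneOn_abs_sub_le hq
  have hlim : Tendsto (fun n : ℕ => (φ 1 - φ 0) * (1 / (n : ℝ))) atTop (𝓝 0) := by
    simpa using tendsto_one_div_atTop_nhds_zero_nat.const_mul (φ 1 - φ 0)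
  rw [tendsto_iff_norm_sub_tendsto_zero]
  refine squeeze_zero' (Eventually.of_forall fun n => norm_nonneg _) ?_ hlim
  filter_upwards [eventually_gt_atTop 0] with n hn
  have hint := intervalIntegrable_of_boundedVariationOn hq
  rw [integral_eq_sum_cells hn hint, Finset.mul_sum, ← Finset.sum_sub_distrib,
    ← sum_cell_increments hn φ, Finset.sum_mul]
  -- Each cell contributes at most `1/n` times the increment of `φ`, so the total error is `(φ 1 - φ
  -- 0) / n`.
  refine (norm_sum_le _ _).trans (Finset.sum_le_sum fun k hk => ?_)
  have hk' := Finset.mem_range.1 hk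
  have hle := grid_le_succ n k
  have hcell : IntervalIntegrable q volume ((k : ℝ) / n) ((k + 1 : ℕ) / n) := by
    refine hint.mono_set ?_
    rw [uIcc_of_le hle, uIcc_of_le zero_le_one]
    exact cell_subset hk'
  have hconst : 1 / (n : ℝ) * q ((k : ℝ) / n) =
      ∫ _ in ((k : ℝ) / n)..((k + 1 : ℕ) / n), q ((k : ℝ) / n) := by
    rw [intervalIntegral.integral_const, cell_length, smul_eq_mul]
  rw [hconst, ← intervalIntegral.integral_sub (by simp) hcell, ← cell_length k]
  refine (intervalIntegral.norm_integral_le_of_norm_le_const fun s hs => ?_).trans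
    (mul_le_mul_of_nonneg_left (abs_of_nonneg (sub_nonneg.2 hle)).le ?_)
  · rw [uIoc_of_le hle] at hs
    have hs' : s ∈ Icc ((k : ℝ) / n) ((k + 1 : ℕ) / n) := Ioc_subset_Icc_self hs
    rw [Real.norm_eq_abs, abs_sub_comm]
    refine (h _ (cell_subset hk' (left_mem_Icc.2 hle)) s (cell_subset hk' hs') hs.1.le).trans ?_
    have := hφ (cell_subset hk' hs') (cell_subset hk' (right_mem_Icc.2 hle)) hs.2
    linarith
  · exact sub_nonneg.2
      (hφ (cell_subset hk' (left_mem_Icc.2 hle)) (cell_subset hk' (right_mem_Icc.2 hle)) hle)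

/-- The index of the grid cell `(k/n, (k+1)/n]` containing `s`. -/
noncomputable def cellIndex (n : ℕ) (s : ℝ) : ℕ := ⌈n * s⌉₊ - 1

lemma cellIndex_eq {n k : ℕ} (hn : 0 < n) {s : ℝ}
    (hs : s ∈ Ioc ((k : ℝ) / n) ((k + 1 : ℕ) / n)) : cellIndex n s = k := by
  have hn' : (0 : ℝ) < n := by exact_mod_cast hn
  have h : ⌈n * s⌉₊ = k + 1 := by
    rw [Nat.ceil_eq_iff (by omega)]
    refine ⟨?_, ?_⟩
    · rw [Nat.add_sub_cancel, mul_comm]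
      exact (div_lt_iff₀ hn').1 hs.1
    · rw [mul_comm]
      exact (le_div_iff₀ hn').1 hs.2
  rw [cellIndex, h, Nat.add_sub_cancel]

lemma mem_cell {n : ℕ} (hn : 0 < n) {s : ℝ} (hs : s ∈ Ioc (0 : ℝ) 1) :
    cellIndex n s < n ∧ s ∈ Ioc ((cellIndex n s : ℝ) / n) ((cellIndex n s + 1 : ℕ) / n) := by
  have hn' : (0 : ℝ) < n := by exact_mod_cast hn
  have hpos : 0 < ⌈n * s⌉₊ := Nat.ceil_pos.2 (mul_pos hn' hs.1)
  have h1 : cellIndex n s + 1 = ⌈n * s⌉₊ := Nat.sub_add_cancel hpos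
  have hle : ⌈n * s⌉₊ ≤ n := Nat.ceil_le.2 (by nlinarith [hs.2])
  refine ⟨by omega, ?_, ?_⟩
  · rw [div_lt_iff₀ hn', mul_comm]
    exact Nat.lt_ceil.1 (by omega)
  · rw [h1, le_div_iff₀ hn', mul_comm]
    exact Nat.le_ceil _

lemma le_grid_iff {n k : ℕ} (hn : 0 < n) {s : ℝ}
    (hs : s ∈ Ioc ((k : ℝ) / n) ((k + 1 : ℕ) / n)) (i : ℕ) : s ≤ (i : ℝ) / n ↔ k < i := by
  have hn' : (0 : ℝ) < n := by exact_mod_cast hn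
  constructor
  · intro h
    have := (div_lt_div_iff_of_pos_right hn').1 (hs.1.trans_le h)
    exact_mod_cast this
  · intro h
    refine hs.2.trans ?_
    gcongr
    exact h

lemma measurable_cellIndex (n : ℕ) : Measurable (cellIndex n) :=
  (measurable_from_nat (f := fun k => k - 1)).comp
    (Nat.measurable_ceil.comp (measurable_const_mul (n : ℝ)))

lemma ae_mem_Ioc_unitMeasure : ∀ᵐ s ∂unitMeasure, s ∈ Ioc (0 : ℝ) 1 := by
  rw [unitMeasure, ← restrict_Ioc_eq_restrict_Icc]
  exact ae_restrict_mem measurableSet_Ioc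

lemma integral_unitMeasure (q : ℝ → ℝ) : ∫ s, q s ∂unitMeasure = ∫ s in (0 : ℝ)..1, q s := by
  rw [unitMeasure, intervalIntegral.integral_of_le zero_le_one, integral_Icc_eq_integral_Ioc]

lemma intervalIntegrable_of_integrable_unitMeasure {q : ℝ → ℝ} (hq : Integrable q unitMeasure) :
    IntervalIntegrable q volume 0 1 := by
  rw [intervalIntegrable_iff_integrableOn_Ioc_of_le zero_le_one, ← integrableOn_Icc_iff_integrableOn_Ioc]
  exact hq

lemma integral_unitMeasure_eq_sum {n : ℕ} (hn : 0 < n) {q : ℝ → ℝ} (hq : Integrable q unitMeasure)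
    (r : ℕ → ℝ → ℝ) (hqr : ∀ᵐ s ∂unitMeasure, q s = r (cellIndex n s) s) :
    ∫ s, q s ∂unitMeasure =
      ∑ k ∈ Finset.range n, ∫ s in ((k : ℝ) / n)..((k + 1 : ℕ) / n), r k s := by
  rw [integral_unitMeasure, integral_eq_sum_cells hn (intervalIntegrable_of_integrable_unitMeasure hq)]
  refine Finset.sum_congr rfl fun k hk => intervalIntegral.integral_congr_ae ?_
  rw [unitMeasure, ae_restrict_iff' measurableSet_Icc] at hqr
  filter_upwards [hqr] with s h hs
  rw [uIoc_of_le (grid_le_succ n k)] at hs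
  rw [h (cell_subset (Finset.mem_range.1 hk) (Ioc_subset_Icc_self hs)), cellIndex_eq hn hs]

end WickApprox

namespace WickApprox

/-! ### The step approximation of an integrand and its oscillating error -/

/-- The leading part `f'(k/n) (s - k/n - 1/(2n))` of the error of the step approximation on the cell
`(k/n, (k+1)/n]`. -/
noncomputable def oscFun (f : ℝ → ℝ) (n : ℕ) (s : ℝ) : ℝ :=
  unitDeriv f ((cellIndex n s : ℝ) / n) * (s - (cellIndex n s : ℝ) / n - 1 / (n : ℝ) / 2)

lemma measurable_oscFun (f : ℝ → ℝ) (n : ℕ) : Measurable (oscFun f n) := by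
  have h1 : Measurable fun s => unitDeriv f ((cellIndex n s : ℝ) / n) :=
    (measurable_from_nat (f := fun k : ℕ => unitDeriv f ((k : ℝ) / n))).comp (measurable_cellIndex n)
  have h2 : Measurable fun s => (cellIndex n s : ℝ) / n :=
    (measurable_from_nat (f := fun k : ℕ => (k : ℝ) / n)).comp (measurable_cellIndex n)
  exact h1.mul ((measurable_id.sub h2).sub_const _)

lemma abs_oscFun_le {f : ℝ → ℝ} {M : ℝ} (hM0 : 0 ≤ M)
    (hM : ∀ s ∈ Icc (0 : ℝ) 1, |unitDeriv f s| ≤ M) {n : ℕ} (hn : 0 < n) {s : ℝ}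
    (hs : s ∈ Ioc (0 : ℝ) 1) : ‖oscFun f n s‖ ≤ M * (1 / n) := by
  obtain ⟨hk, hs'⟩ := mem_cell hn hs
  rw [oscFun, norm_mul, Real.norm_eq_abs, Real.norm_eq_abs]
  refine mul_le_mul (hM _ (grid_mem_Icc hk.le)) ?_ (abs_nonneg _) hM0
  have h1 := cell_length (n := n) (cellIndex n s)
  have h2 : 0 < 1 / (n : ℝ) := by positivity
  rw [abs_le]
  constructor <;> linarith [hs'.1, hs'.2]

lemma memLp_oscFun {f : ℝ → ℝ} (hf : HasBVDeriv f) {n : ℕ} (hn : 0 < n) :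
    MemLp (oscFun f n) 2 unitMeasure := by
  obtain ⟨M, hM0, hM⟩ := exists_abs_le_of_boundedVariationOn hf.boundedVariation
  exact MemLp.of_bound (measurable_oscFun f n).aestronglyMeasurable (M * (1 / n))
    (ae_mem_Ioc_unitMeasure.mono fun s hs => abs_oscFun_le hM0 hM hn hs)

/-- The step function with values `schemeCoeff f n k`. -/
noncomputable def schemeVector (f : ℝ → ℝ) (n : ℕ) : Lp ℝ 2 unitMeasure :=
  ∑ k ∈ Finset.range n,
    schemeCoeff f n k • (indicatorL2 (gridPoint n (k + 1)) - indicatorL2 (gridPoint n k))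

/-- The increments of the scheme start at grid point `0`, which is not among the generators of
`gridSubspace`. -/
lemma indicatorL2_gridPoint_zero (n : ℕ) : indicatorL2 (gridPoint n 0) = 0 := by
  have h : ((gridPoint n 0 : unitInterval) : ℝ) = 0 := by simp [gridPoint]
  refine (Lp.eq_zero_iff_ae_eq_zero).2 ?_
  rw [indicatorL2]
  refine indicatorConstLp_coeFn.trans (ae_of_all _ fun s => ?_)
  simp [h]

lemma indicatorL2_gridPoint_mem {n i : ℕ} (hi : i ≤ n) :
    indicatorL2 (gridPoint n i) ∈ gridSubspace n := by
  rcases Nat.eq_zero_or_pos i with rfl | hi0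
  · rw [indicatorL2_gridPoint_zero]
    exact zero_mem _
  · exact indicatorL2_mem_gridSubspace (Finset.mem_Icc.2 ⟨hi0, hi⟩)

lemma schemeVector_mem (f : ℝ → ℝ) (n : ℕ) : schemeVector f n ∈ gridSubspace n :=
  Submodule.sum_mem _ fun _ hk => Submodule.smul_mem _ _ (Submodule.sub_mem _
    (indicatorL2_gridPoint_mem (Nat.succ_le_of_lt (Finset.mem_range.1 hk)))
    (indicatorL2_gridPoint_mem (Finset.mem_range.1 hk).le))

lemma coeFn_indicatorL2_gridPoint {n i : ℕ} (hn : 0 < n) (hi : i ≤ n) :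
    ∀ᵐ s ∂unitMeasure, indicatorL2 (gridPoint n i) s = if cellIndex n s < i then 1 else 0 := by
  have h : ((gridPoint n i : unitInterval) : ℝ) = i / n := by
    rw [gridPoint, projIcc_of_mem _ (grid_mem_Icc hi)]
  rw [indicatorL2]
  filter_upwards [indicatorConstLp_coeFn (p := 2)
    (hs := measurableSet_Ioc (a := (0 : ℝ)) (b := (gridPoint n i : ℝ)))
    (hμs := measure_ne_top unitMeasure _) (c := (1 : ℝ)), ae_mem_Ioc_unitMeasure] with s h1 h2
  rw [h1, h]
  simp only [indicator_apply, mem_Ioc, h2.1, true_and, le_grid_iff hn (mem_cell hn h2).2]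

lemma coeFn_schemeVector {f : ℝ → ℝ} {n : ℕ} (hn : 0 < n) :
    ∀ᵐ s ∂unitMeasure, schemeVector f n s = schemeCoeff f n (cellIndex n s) := by
  have hall : ∀ᵐ s ∂unitMeasure, ∀ k ∈ Finset.range n,
      (schemeCoeff f n k • (indicatorL2 (gridPoint n (k + 1)) - indicatorL2 (gridPoint n k)) :
        Lp ℝ 2 unitMeasure) s = if k = cellIndex n s then schemeCoeff f n k else 0 := by
    refine (Finset.eventually_all _).2 fun k hk => ?_
    have hk' := Finset.mem_range.1 hk
    filter_upwards [Lp.coeFn_smul (schemeCoeff f n k)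
        (indicatorL2 (gridPoint n (k + 1)) - indicatorL2 (gridPoint n k)),
      Lp.coeFn_sub (indicatorL2 (gridPoint n (k + 1))) (indicatorL2 (gridPoint n k)),
      coeFn_indicatorL2_gridPoint hn (Nat.succ_le_of_lt hk'),
      coeFn_indicatorL2_gridPoint hn hk'.le] with s h1 h2 h3 h4
    rw [h1, Pi.smul_apply, h2, Pi.sub_apply, h3, h4, smul_eq_mul]
    rcases lt_trichotomy (cellIndex n s) k with h | h | h
    · rw [if_pos (by omega), if_pos h, if_neg (by omega)]; ring
    · rw [if_pos (by omega), if_neg (by omega), if_pos h.symm]; ring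
    · rw [if_neg (by omega), if_neg (by omega), if_neg (by omega)]; ring
  filter_upwards [coeFn_finsetSum (Finset.range n) fun k => (schemeCoeff f n k •
    (indicatorL2 (gridPoint n (k + 1)) - indicatorL2 (gridPoint n k)) : Lp ℝ 2 unitMeasure),
    hall, ae_mem_Ioc_unitMeasure] with s h1 h2 h3
  rw [schemeVector, h1, Finset.sum_congr rfl h2, Finset.sum_ite_eq',
    if_pos (Finset.mem_range.2 (mem_cell hn h3).1)]

lemma integrable_inner_Lp {u v : Lp ℝ 2 unitMeasure} : Integrable (fun s => u s * v s) unitMeasure :=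
  (Lp.memLp u).integrable_mul (Lp.memLp v)

lemma inner_eq_integral_mul (u v : Lp ℝ 2 unitMeasure) :
    inner ℝ u v = ∫ s, u s * v s ∂unitMeasure := by
  rw [L2.inner_def]
  simp [mul_comm]

/-- Hence the Hermite polynomials of the truncated scheme carry the true variance of their Gaussian
argument, and its terms are genuine Wick powers. -/
lemma norm_sq_schemeVector (f : ℝ → ℝ) (n : ℕ) : ‖schemeVector f n‖ ^ 2 = schemeNormSq f n := by
  rcases Nat.eq_zero_or_pos n with rfl | hn
  · simp [schemeVector, schemeNormSq]
  rw [← real_inner_self_eq_norm_sq, inner_eq_integral_mul,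
    integral_unitMeasure_eq_sum hn integrable_inner_Lp (fun k _ => schemeCoeff f n k ^ 2),
    schemeNormSq, Finset.mul_sum]
  · refine Finset.sum_congr rfl fun k _ => ?_
    rw [intervalIntegral.integral_const, cell_length, smul_eq_mul]
  · filter_upwards [coeFn_schemeVector hn] with s h
    rw [h, sq]

/-- The class of `oscFun f n` in `L²([0,1])`. -/
noncomputable def oscVector {f : ℝ → ℝ} (hf : HasBVDeriv f) {n : ℕ} (hn : 0 < n) :
    Lp ℝ 2 unitMeasure :=
  (memLp_oscFun hf hn).toLp (oscFun f n)

lemma coeFn_oscVector {f : ℝ → ℝ} (hf : HasBVDeriv f) {n : ℕ} (hn : 0 < n) :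
    oscVector hf hn =ᵐ[unitMeasure] oscFun f n :=
  MemLp.coeFn_toLp _

lemma integral_cell_sub_midpoint (n k : ℕ) :
    ∫ s in ((k : ℝ) / n)..((k + 1 : ℕ) / n), (s - (k : ℝ) / n - 1 / (n : ℝ) / 2) = 0 := by
  rw [intervalIntegral.integral_sub ((continuous_sub_right _).intervalIntegrable _ _) (by simp),
    intervalIntegral.integral_comp_sub_right (fun x => x), sub_self, cell_length, integral_id,
    intervalIntegral.integral_const, cell_length, smul_eq_mul]
  ring

/-- The origin of the constant `1/12` in the limit. -/
lemma integral_cell_sub_midpoint_sq (n k : ℕ) :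
    ∫ s in ((k : ℝ) / n)..((k + 1 : ℕ) / n), (s - (k : ℝ) / n - 1 / (n : ℝ) / 2) ^ 2 =
      (1 / (n : ℝ)) ^ 3 / 12 := by
  simp only [sub_sub]
  rw [intervalIntegral.integral_comp_sub_right (fun x => x ^ 2), integral_pow]
  push_cast
  ring

/-- Grid step functions are constant on each cell, and the oscillating error has mean zero there
because it is centred at the midpoint. The correction `f'_k Δ / 2` in the scheme is what centres it.
-/
lemma oscVector_mem_orthogonal {f : ℝ → ℝ} (hf : HasBVDeriv f) {n : ℕ} (hn : 0 < n) :
    oscVector hf hn ∈ (gridSubspace n)ᗮ := by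
  have h : gridSubspace n ≤ (innerSL ℝ (oscVector hf hn)).toLinearMap.ker := by
    refine Submodule.span_le.2 fun v hv => ?_
    obtain ⟨i, hi, rfl⟩ := hv
    have hi' := Finset.mem_Icc.1 (Finset.mem_coe.1 hi)
    change inner ℝ (oscVector hf hn) (indicatorL2 (gridPoint n i)) = 0
    rw [inner_eq_integral_mul, integral_unitMeasure_eq_sum hn integrable_inner_Lp
      (fun k s => (unitDeriv f ((k : ℝ) / n) * if k < i then 1 else 0) *
        (s - (k : ℝ) / n - 1 / (n : ℝ) / 2))]
    · simp only [intervalIntegral.integral_const_mul, integral_cell_sub_midpoint, mul_zero,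
        Finset.sum_const_zero]
    · filter_upwards [coeFn_oscVector hf hn, coeFn_indicatorL2_gridPoint hn hi'.2] with s h1 h2
      rw [h1, h2, oscFun]
      ring
  refine (Submodule.mem_orthogonal' _ _).2 fun u hu => ?_
  exact LinearMap.mem_ker.1 (h hu)

lemma inner_oscVector {f g : ℝ → ℝ} (hf : HasBVDeriv f) (hg : HasBVDeriv g) {n : ℕ} (hn : 0 < n) :
    inner ℝ (oscVector hf hn) (oscVector hg hn) =
      (1 / (n : ℝ)) ^ 2 / 12 * (1 / (n : ℝ) * ∑ k ∈ Finset.range n,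
        unitDeriv f ((k : ℝ) / n) * unitDeriv g ((k : ℝ) / n)) := by
  rw [inner_eq_integral_mul, integral_unitMeasure_eq_sum hn integrable_inner_Lp
    (fun k s => unitDeriv f ((k : ℝ) / n) * unitDeriv g ((k : ℝ) / n) *
      (s - (k : ℝ) / n - 1 / (n : ℝ) / 2) ^ 2), Finset.mul_sum, Finset.mul_sum]
  · refine Finset.sum_congr rfl fun k _ => ?_
    rw [intervalIntegral.integral_const_mul, integral_cell_sub_midpoint_sq]
    ring
  · filter_upwards [coeFn_oscVector hf hn, coeFn_oscVector hg hn] with s h1 h2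
    rw [h1, h2, oscFun, oscFun]
    ring

lemma norm_oscVector_le {f : ℝ → ℝ} (hf : HasBVDeriv f) :
    ∃ M, 0 ≤ M ∧ ∀ n (hn : 0 < n), ‖oscVector hf hn‖ ≤ M / n := by
  obtain ⟨M, hM0, hM⟩ := exists_abs_le_of_boundedVariationOn hf.boundedVariation
  refine ⟨M, hM0, fun n hn => ?_⟩
  have h := Lp.norm_le_of_ae_bound (f := oscVector hf hn) (C := M * (1 / n)) (by positivity) (by
    filter_upwards [coeFn_oscVector hf hn, ae_mem_Ioc_unitMeasure] with s h1 h2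
    rw [h1]
    exact abs_oscFun_le hM0 hM hn h2)
  refine h.trans (le_of_eq ?_)
  have h1 : measureUnivNNReal unitMeasure = 1 := by
    rw [← ENNReal.coe_inj, coe_measureUnivNNReal, unitMeasure]
    simp
  rw [h1]
  simp
  ring

/-- The mean value inequality for `x ↦ f x - f'(t) x`, whose derivative on `[t, s]` is bounded by
the increment of `φ`. Continuity of `f'` is not needed. -/
lemma abs_taylor_remainder_le {f φ : ℝ → ℝ} (hf : DifferentiableOn ℝ f (Icc 0 1))
    (hφ : MonotoneOn φ (Icc 0 1))
    (h : ∀ r ∈ Icc (0 : ℝ) 1, ∀ s ∈ Icc (0 : ℝ) 1, r ≤ s →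
      |unitDeriv f s - unitDeriv f r| ≤ φ s - φ r)
    {t s : ℝ} (ht : t ∈ Icc (0 : ℝ) 1) (hs : s ∈ Icc (0 : ℝ) 1) (hts : t ≤ s) :
    |f s - f t - unitDeriv f t * (s - t)| ≤ (φ s - φ t) * (s - t) := by
  have hsub : Icc t s ⊆ Icc (0 : ℝ) 1 := Icc_subset_Icc ht.1 hs.2
  have hd (x : ℝ) (hx : x ∈ Icc t s) : HasDerivWithinAt (fun x => f x - unitDeriv f t * x)
      (unitDeriv f x - unitDeriv f t * 1) (Icc t s) x :=
    ((hf x (hsub hx)).hasDerivWithinAt.mono hsub).sub ((hasDerivWithinAt_id x _).const_mul _)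
  have := (convex_Icc t s).norm_image_sub_le_of_norm_hasDerivWithin_le hd (C := φ s - φ t)
    (fun x hx => ?_) (left_mem_Icc.2 hts) (right_mem_Icc.2 hts)
  · rw [Real.norm_eq_abs, Real.norm_eq_abs, abs_of_nonneg (sub_nonneg.2 hts)] at this
    refine le_trans (le_of_eq ?_) this
    congr 1
    ring
  · rw [mul_one, Real.norm_eq_abs]
    exact (h t ht x (hsub hx) hx.1).trans (sub_le_sub_right (hφ (hsub hx) hs hx.2) _)

/-- Up to an error of order `n^(-3/2)`, the integrand is its step approximation plus the
oscillating error. -/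
lemma norm_sub_schemeVector_sub_oscVector_le {f : ℝ → ℝ} (hf : HasBVDeriv f) :
    ∃ V, 0 ≤ V ∧ ∀ n (hn : 0 < n),
      ‖hf.memLp.toLp f - schemeVector f n - oscVector hf hn‖ ^ 2 ≤ V ^ 2 * (1 / (n : ℝ)) ^ 3 := by
  obtain ⟨φ, hφ, h⟩ := exists_monotoneOn_abs_sub_le hf.boundedVariation
  refine ⟨φ 1 - φ 0, sub_nonneg.2 (hφ (by simp) (by simp) zero_le_one), fun n hn => ?_⟩
  set E := hf.memLp.toLp f - schemeVector f n - oscVector hf hn with hE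
  -- The midpoint terms of the scheme and of the oscillating error cancel, leaving the first-order
  -- Taylor remainder at the left end of the cell.
  have hEs : ∀ᵐ s ∂unitMeasure, E s = f s - f ((cellIndex n s : ℝ) / n) -
      unitDeriv f ((cellIndex n s : ℝ) / n) * (s - (cellIndex n s : ℝ) / n) := by
    filter_upwards [Lp.coeFn_sub (hf.memLp.toLp f - schemeVector f n) (oscVector hf hn),
      Lp.coeFn_sub (hf.memLp.toLp f) (schemeVector f n), hf.memLp.coeFn_toLp,
      coeFn_schemeVector (f := f) hn, coeFn_oscVector hf hn] with s h1 h2 h3 h4 h5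
    rw [hE, h1, Pi.sub_apply, h2, Pi.sub_apply, h3, h4, h5, oscFun, schemeCoeff]
    ring
  have hincr (k : ℕ) (hk : k < n) : 0 ≤ φ ((k + 1 : ℕ) / n) - φ ((k : ℝ) / n) :=
    sub_nonneg.2 (hφ (grid_mem_Icc hk.le) (grid_mem_Icc (Nat.succ_le_of_lt hk)) (grid_le_succ n k))
  rw [← real_inner_self_eq_norm_sq, inner_eq_integral_mul, integral_unitMeasure_eq_sum hn
    integrable_inner_Lp (fun k s => (f s - f ((k : ℝ) / n) -
      unitDeriv f ((k : ℝ) / n) * (s - (k : ℝ) / n)) ^ 2)]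
  · calc ∑ k ∈ Finset.range n, ∫ s in ((k : ℝ) / n)..((k + 1 : ℕ) / n), (f s - f ((k : ℝ) / n) -
          unitDeriv f ((k : ℝ) / n) * (s - (k : ℝ) / n)) ^ 2
        ≤ ∑ k ∈ Finset.range n, (φ ((k + 1 : ℕ) / n) - φ ((k : ℝ) / n)) ^ 2 * (1 / (n : ℝ)) ^ 3 := by
          refine Finset.sum_le_sum fun k hk => ?_
          have hk' := Finset.mem_range.1 hk
          have hle := grid_le_succ n k
          refine (Real.le_norm_self _).trans ((intervalIntegral.norm_integral_le_of_norm_le_const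
            (C := ((φ ((k + 1 : ℕ) / n) - φ ((k : ℝ) / n)) * (1 / n)) ^ 2)
            fun s hs => ?_).trans (le_of_eq ?_))
          · rw [uIoc_of_le hle] at hs
            have hs' : s ∈ Icc ((k : ℝ) / n) ((k + 1 : ℕ) / n) := Ioc_subset_Icc_self hs
            rw [norm_pow, Real.norm_eq_abs]
            refine pow_le_pow_left₀ (abs_nonneg _) ?_ 2
            refine (abs_taylor_remainder_le hf.differentiable hφ h (grid_mem_Icc hk'.le)
              (cell_subset hk' hs') hs.1.le).trans ?_
            have h1 := hφ (cell_subset hk' hs') (grid_mem_Icc (Nat.succ_le_of_lt hk')) hs.2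
            have h2 := cell_length (n := n) k
            exact mul_le_mul (by linarith) (by linarith [hs.2]) (by linarith [hs.1]) (hincr k hk')
          · rw [cell_length, abs_of_nonneg (by positivity)]
            ring
      -- Comparing the sum of squares with the square of the telescoping sum saves a factor `n` over
      -- bounding each increment by the total variation; this puts the remainder strictly below the
      -- leading order `1/n`.
      _ ≤ (∑ k ∈ Finset.range n, (φ ((k + 1 : ℕ) / n) - φ ((k : ℝ) / n))) ^ 2 *
          (1 / (n : ℝ)) ^ 3 := by
          rw [← Finset.sum_mul]
          refine mul_le_mul_of_nonneg_right ?_ (by positivity)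
          exact Finset.sum_sq_le_sq_sum_of_nonneg fun k hk => hincr k (Finset.mem_range.1 hk)
      _ = _ := by rw [sum_cell_increments hn]
  · filter_upwards [hEs] with s h1
    rw [h1, sq]

end WickApprox

namespace WickApprox

/-! ### Expansion of the pairing of two Wick series -/

section Pairing

variable {a b : ℕ → ℝ} {C D : ℝ}

/-- The two coefficients supply `1/k!` each and the pairing uses up one, so the power series is
entire and its radius can be enlarged at will below. -/
lemma HasFactorialDecay.summable_pairing (ha : HasFactorialDecay a C) (hb : HasFactorialDecay b D)
    {R : ℝ} (hR : 0 ≤ R) : Summable fun k => |a k * b k * k.factorial| * R ^ k := by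
  have hC : 0 ≤ C := zero_le_one.trans ha.1
  have hD : 0 ≤ D := zero_le_one.trans hb.1
  refine Summable.of_nonneg_of_le (fun k => by positivity) (fun k => ?_)
    ((Real.summable_pow_div_factorial (C * D * R)).mul_left (C * D))
  have hf : (0 : ℝ) < k.factorial := by positivity
  rw [abs_mul, abs_mul, Nat.abs_cast]
  calc |a k| * |b k| * k.factorial * R ^ k
      ≤ C ^ (k + 1) / k.factorial * (D ^ (k + 1) / k.factorial) * k.factorial * R ^ k := by
        gcongr
        exacts [ha.abs_le k, hb.abs_le k]
    _ = C * D * ((C * D * R) ^ k / k.factorial) := by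
        field_simp
        ring

lemma HasFactorialDecay.hasSum_pairing (ha : HasFactorialDecay a C) (hb : HasFactorialDecay b D)
    (z : ℝ) : HasSum (fun k => a k * b k * k.factorial * z ^ k) (wickPairing a b z) := by
  refine (Summable.of_norm ?_).hasSum
  simpa only [norm_mul, norm_pow, Real.norm_eq_abs, abs_mul] using
    ha.summable_pairing hb (abs_nonneg z)

lemma abs_pow_sub_le {z w R : ℝ} (hR : 1 ≤ R) (hz : |z| ≤ R) (hw : |w| ≤ R) (k : ℕ) :
    |w ^ k - z ^ k - k * z ^ (k - 1) * (w - z)| ≤ (4 * R) ^ k * (w - z) ^ 2 := by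
  have hR0 : 0 ≤ R := zero_le_one.trans hR
  -- The induction runs with the polynomial factor `k²`; afterwards `k² ≤ 4 ^ k` makes the bound
  -- geometric, to be summed as a pairing of radius `4R`.
  have hsq : |w ^ k - z ^ k - k * z ^ (k - 1) * (w - z)| ≤ (k : ℝ) ^ 2 * R ^ k * (w - z) ^ 2 := by
    induction k with
    | zero => simp
    | succ k ih =>
      have hz' : |z ^ (k - 1)| ≤ R ^ (k + 1) := by
        rw [abs_pow]
        exact (pow_le_pow_left₀ (abs_nonneg z) hz _).trans (pow_le_pow_right₀ hR (by omega))
      have hstep : w ^ (k + 1) - z ^ (k + 1) - (k + 1 : ℕ) * z ^ (k + 1 - 1) * (w - z) =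
          w * (w ^ k - z ^ k - k * z ^ (k - 1) * (w - z)) + k * z ^ (k - 1) * (w - z) ^ 2 := by
        rcases k with _ | k
        · simp
        · simp only [Nat.add_sub_cancel]; push_cast; ring
      rw [hstep]
      calc |w * (w ^ k - z ^ k - k * z ^ (k - 1) * (w - z)) + k * z ^ (k - 1) * (w - z) ^ 2|
          ≤ |w| * |w ^ k - z ^ k - k * z ^ (k - 1) * (w - z)| +
              k * |z ^ (k - 1)| * (w - z) ^ 2 := by
            refine (abs_add_le _ _).trans ?_
            rw [abs_mul, abs_mul, abs_mul, Nat.abs_cast, abs_of_nonneg (sq_nonneg (w - z))]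
        _ ≤ R * ((k : ℝ) ^ 2 * R ^ k * (w - z) ^ 2) + k * R ^ (k + 1) * (w - z) ^ 2 := by
            gcongr
        _ = ((k : ℝ) ^ 2 + k) * (R ^ (k + 1) * (w - z) ^ 2) := by ring
        _ ≤ ((k + 1 : ℕ) : ℝ) ^ 2 * (R ^ (k + 1) * (w - z) ^ 2) := by
            refine mul_le_mul_of_nonneg_right ?_ (by positivity)
            push_cast
            nlinarith [(Nat.cast_nonneg k : (0 : ℝ) ≤ k)]
        _ = _ := by ring
  refine hsq.trans (mul_le_mul_of_nonneg_right ?_ (sq_nonneg _))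
  rw [mul_pow]
  refine mul_le_mul_of_nonneg_right ?_ (by positivity)
  have h : (k : ℝ) ≤ 2 ^ k := by exact_mod_cast Nat.lt_two_pow_self.le
  calc (k : ℝ) ^ 2 ≤ (2 ^ k) ^ 2 := pow_le_pow_left₀ (by positivity) h 2
    _ = 4 ^ k := by rw [← pow_mul, mul_comm, pow_mul]; norm_num

/-- The termwise derivative of the pairing is the pairing of the differentiated coefficients, since
`(k + 1) (k + 1)! = (k + 1)² k!`. This is how `E[F' G']` enters the limit. -/
lemma HasFactorialDecay.hasSum_pairing_shift (ha : HasFactorialDecay a C)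
    (hb : HasFactorialDecay b D) (z : ℝ) :
    HasSum (fun k : ℕ => a k * b k * k.factorial * (k * z ^ (k - 1)))
      (wickPairing (fun k => (k + 1) * a (k + 1)) (fun k => (k + 1) * b (k + 1)) z) := by
  refine (hasSum_nat_add_iff' 1).1 ?_
  simp only [Finset.range_one, Finset.sum_singleton, CharP.cast_eq_zero, zero_mul, mul_zero,
    sub_zero, Nat.add_sub_cancel]
  refine (ha.shift.hasSum_pairing hb.shift z).congr_fun fun k => ?_
  rw [Nat.factorial_succ]
  push_cast
  ring

/-- First-order expansion of the pairing, with a quadratic remainder. -/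
lemma HasFactorialDecay.isBigO_pairing (ha : HasFactorialDecay a C) (hb : HasFactorialDecay b D)
    {A : ℝ} {B : ℕ → ℝ} (hB : Tendsto B atTop (𝓝 A)) :
    (fun n => wickPairing a b (B n) - wickPairing a b A -
      wickPairing (fun k => (k + 1) * a (k + 1)) (fun k => (k + 1) * b (k + 1)) A * (B n - A))
      =O[atTop] fun n => (B n - A) ^ 2 := by
  set R : ℝ := |A| + 1
  have hR : 1 ≤ R := by simp [R]
  have hsum := ha.summable_pairing hb (R := 4 * R) (by positivity)
  refine Asymptotics.IsBigO.of_bound (∑' k, |a k * b k * k.factorial| * (4 * R) ^ k) ?_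
  have hBR : ∀ᶠ n in atTop, |B n| ≤ R :=
    (hB.abs.eventually_lt_const (lt_add_one |A|)).mono fun n h => h.le
  filter_upwards [hBR] with n hn
  have h := ((ha.hasSum_pairing hb (B n)).sub (ha.hasSum_pairing hb A)).sub
    ((ha.hasSum_pairing_shift hb A).mul_right (B n - A))
  rw [← h.tsum_eq, ← tsum_mul_right]
  refine tsum_of_norm_bounded (hsum.mul_right _).hasSum fun k => ?_
  rw [← mul_sub, mul_assoc _ ((k : ℝ) * A ^ (k - 1)), ← mul_sub, norm_mul, Real.norm_eq_abs,
    mul_assoc |_|, Real.norm_eq_abs, Real.norm_eq_abs, abs_of_nonneg (sq_nonneg (B n - A))]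
  exact mul_le_mul_of_nonneg_left (abs_pow_sub_le hR (le_add_of_nonneg_right zero_le_one) hn k)
    (abs_nonneg _)

/-- `a'` agrees with `a` up to index `n`, and each later coefficient is kept or dropped. -/
def IsTruncation (n : ℕ) (a' a : ℕ → ℝ) : Prop :=
  ∀ k, a' k = a k ∨ n < k ∧ a' k = 0

lemma IsTruncation.abs_le {n : ℕ} {a' : ℕ → ℝ} (h : IsTruncation n a' a) (k : ℕ) :
    |a' k| ≤ |a k| := by
  rcases h k with h | ⟨_, h⟩
  · rw [h]
  · rw [h, abs_zero]
    exact abs_nonneg _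

lemma IsTruncation.refl (n : ℕ) (a : ℕ → ℝ) : IsTruncation n a a := fun _ => Or.inl rfl

/-- Only terms with `k > n` can change, and summing with radius `2R` in place of `R` gains the
factor `2 ^ (-n)` on them. -/
lemma HasFactorialDecay.isBigO_truncation (ha : HasFactorialDecay a C) (hb : HasFactorialDecay b D)
    {a' b' : ℕ → ℕ → ℝ} (ha' : ∀ n, IsTruncation n (a' n) a) (hb' : ∀ n, IsTruncation n (b' n) b)
    {A : ℝ} {B : ℕ → ℝ} (hB : Tendsto B atTop (𝓝 A)) :
    (fun n => wickPairing (a' n) (b' n) (B n) - wickPairing a b (B n)) =O[atTop]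
      fun n => (1 / 2 : ℝ) ^ n := by
  set R : ℝ := |A| + 1
  have hR : 0 ≤ R := by positivity
  have hsum := ha.summable_pairing hb (R := 2 * R) (by positivity)
  refine Asymptotics.IsBigO.of_bound (∑' k, |a k * b k * k.factorial| * (2 * R) ^ k) ?_
  have hBR : ∀ᶠ n in atTop, |B n| ≤ R :=
    (hB.abs.eventually_lt_const (lt_add_one |A|)).mono fun n h => h.le
  filter_upwards [hBR] with n hn
  have h := ((ha.of_abs_le (ha' n).abs_le).hasSum_pairing (hb.of_abs_le (hb' n).abs_le) (B n)).sub
    (ha.hasSum_pairing hb (B n))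
  rw [← h.tsum_eq, ← tsum_mul_right]
  refine tsum_of_norm_bounded (hsum.mul_right _).hasSum fun k => ?_
  have hcases : a' n k * b' n k = a k * b k ∨ n < k ∧ a' n k * b' n k = 0 := by
    rcases ha' n k with h1 | ⟨hk, h1⟩
    · rcases hb' n k with h2 | ⟨hk, h2⟩
      · exact Or.inl (by rw [h1, h2])
      · exact Or.inr ⟨hk, by rw [h2, mul_zero]⟩
    · exact Or.inr ⟨hk, by rw [h1, zero_mul]⟩
  have h2n : ‖(1 / 2 : ℝ) ^ n‖ = (1 / 2) ^ n := by
    rw [Real.norm_eq_abs, abs_of_nonneg (by positivity)]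
  rcases hcases with h1 | ⟨hk, h1⟩
  · rw [h1, sub_self, norm_zero]
    exact mul_nonneg (mul_nonneg (abs_nonneg _) (pow_nonneg (mul_nonneg zero_le_two hR) k))
      (norm_nonneg _)
  · rw [h1, zero_mul, zero_mul, zero_sub, norm_neg, norm_mul, norm_pow, Real.norm_eq_abs,
      Real.norm_eq_abs, h2n, mul_assoc |_|]
    refine mul_le_mul_of_nonneg_left ?_ (abs_nonneg _)
    calc |B n| ^ k ≤ R ^ k := pow_le_pow_left₀ (abs_nonneg _) hn k
      _ = (2 * R) ^ k * (1 / 2) ^ k := by rw [← mul_pow]; ring_nf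
      _ ≤ (2 * R) ^ k * (1 / 2) ^ n :=
        mul_le_mul_of_nonneg_left
          (pow_le_pow_of_le_one (by norm_num) (by norm_num) hk.le) (by positivity)

end Pairing

/-! ### Rates of convergence against `n²`. -/

lemma tendsto_sq_mul_of_isBigO {x y : ℕ → ℝ} (h : x =O[atTop] y)
    (hy : Tendsto (fun n : ℕ => (n : ℝ) ^ 2 * y n) atTop (𝓝 0)) :
    Tendsto (fun n : ℕ => (n : ℝ) ^ 2 * x n) atTop (𝓝 0) :=
  ((Asymptotics.isBigO_refl (fun n : ℕ => (n : ℝ) ^ 2) atTop).mul h).trans_tendsto hy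

/-- The rate `n^(-3/2)`. -/
noncomputable def rate (n : ℕ) : ℝ := 1 / n * (1 / √n)

lemma rate_nonneg (n : ℕ) : 0 ≤ rate n := by unfold rate; positivity

lemma tendsto_one_div_sqrt : Tendsto (fun n : ℕ => 1 / √(n : ℝ)) atTop (𝓝 0) := by
  simpa only [one_div] using!
    tendsto_inv_atTop_zero.comp (Real.tendsto_sqrt_atTop.comp tendsto_natCast_atTop_atTop)

lemma tendsto_rate : Tendsto rate atTop (𝓝 0) := by
  have h := tendsto_one_div_atTop_nhds_zero_nat.mul tendsto_one_div_sqrt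
  rw [mul_zero] at h
  exact h

lemma tendsto_sq_mul_rate_sq : Tendsto (fun n : ℕ => (n : ℝ) ^ 2 * rate n ^ 2) atTop (𝓝 0) := by
  refine (tendsto_one_div_sqrt.pow 2).congr' ?_ |>.trans (by simp)
  filter_upwards [eventually_gt_atTop 0] with n hn
  have : (n : ℝ) ≠ 0 := by positivity
  rw [rate]
  field_simp

lemma tendsto_sq_mul_rate_div : Tendsto (fun n : ℕ => (n : ℝ) ^ 2 * (rate n * (1 / n))) atTop
    (𝓝 0) := by
  refine tendsto_one_div_sqrt.congr' ?_
  filter_upwards [eventually_gt_atTop 0] with n hn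
  have : (n : ℝ) ≠ 0 := by positivity
  rw [rate]
  field_simp

lemma one_div_mul_isBigO_rate : (fun n : ℕ => 1 / (n : ℝ) * (1 / n)) =O[atTop] rate := by
  refine Asymptotics.IsBigO.of_bound 1 ?_
  filter_upwards [eventually_gt_atTop 0] with n hn
  have hn1 : (1 : ℝ) ≤ n := by exact_mod_cast hn
  rw [one_mul, Real.norm_eq_abs, Real.norm_eq_abs, abs_of_nonneg (rate_nonneg n),
    abs_of_nonneg (by positivity), rate]
  gcongr
  exact Real.sqrt_le_iff.2 ⟨by positivity, by nlinarith⟩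

lemma rate_isBigO_one_div : rate =O[atTop] fun n : ℕ => 1 / (n : ℝ) :=
  ((Asymptotics.isBigO_refl (fun n : ℕ => 1 / (n : ℝ)) atTop).mul
    (tendsto_one_div_sqrt.isBigO_one ℝ)).congr_right fun _ => mul_one _

/-! ### Leading errors of subspace approximations in a Hilbert space. -/

section Hilbert

variable {H : Type*} [NormedAddCommGroup H] [InnerProductSpace ℝ H]

lemma isBigO_inner {x y : ℕ → H} {p q : ℕ → ℝ} (hx : x =O[atTop] p) (hy : y =O[atTop] q) :
    (fun n => inner ℝ (x n) (y n)) =O[atTop] fun n => p n * q n :=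
  (Asymptotics.IsBigO.of_bound 1 (Eventually.of_forall fun n => by
    simpa using norm_inner_le_norm (𝕜 := ℝ) (x n) (y n))).trans (hx.norm_left.mul hy.norm_left)

/-- An approximation of `f` along a sequence of subspaces, with leading error `d`. -/
structure HasLeadingError (V : ℕ → Submodule ℝ H) (f : H) (u d : ℕ → H) : Prop where
  mem : ∀ n, u n ∈ V n
  perp : ∀ n, d n ∈ (V n)ᗮ
  lead : d =O[atTop] fun n : ℕ => 1 / (n : ℝ)
  rem : (fun n => f - u n - d n) =O[atTop] rate

variable {V : ℕ → Submodule ℝ H} {f g : H} {u v d e : ℕ → H}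

lemma HasLeadingError.isBigO_sub (hu : HasLeadingError V f u d) :
    (fun n => f - u n) =O[atTop] fun n : ℕ => 1 / (n : ℝ) := by
  simpa using (hu.rem.trans rate_isBigO_one_div).add hu.lead

/-- Better than the evident `O(1/n)`: since `d n` is orthogonal to `v n`, one has `⟨d, g⟩ = ⟨d, g -
v⟩ = O(n^(-2))`, so only the remainder counts. This makes the quadratic terms of the pairing
negligible. -/
lemma HasLeadingError.isBigO_inner_sub (hu : HasLeadingError V f u d)
    (hv : HasLeadingError V g v e) : (fun n => inner ℝ (f - u n) g) =O[atTop] rate := by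
  have h1 : (fun n => inner ℝ (f - u n - d n) g) =O[atTop] rate := by
    simpa using isBigO_inner hu.rem (Asymptotics.isBigO_const_const g (one_ne_zero (α := ℝ)) atTop)
  have h2 : (fun n => inner ℝ (d n) (g - v n)) =O[atTop] rate :=
    (isBigO_inner hu.lead hv.isBigO_sub).trans one_div_mul_isBigO_rate
  refine (h1.add h2).congr_left fun n => ?_
  have h3 : inner ℝ (d n) (v n) = 0 := (Submodule.mem_orthogonal' _ _).1 (hu.perp n) _ (hv.mem n)
  rw [inner_sub_right, h3, sub_zero, ← inner_add_left, sub_add_cancel]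

/-- Passing from the full errors to their leading parts costs `rate n * (1 / n)`, of order
`n^(-5/2)`. -/
lemma HasLeadingError.tendsto_inner (hu : HasLeadingError V f u d) (hv : HasLeadingError V g v e)
    {L : ℝ} (hL : Tendsto (fun n : ℕ => (n : ℝ) ^ 2 * inner ℝ (d n) (e n)) atTop (𝓝 L)) :
    Tendsto (fun n : ℕ => (n : ℝ) ^ 2 * inner ℝ (f - u n) (g - v n)) atTop (𝓝 L) := by
  have h1 := tendsto_sq_mul_of_isBigO (isBigO_inner hu.rem hv.isBigO_sub) tendsto_sq_mul_rate_div
  have h2 := tendsto_sq_mul_of_isBigO ((isBigO_inner hu.lead hv.rem).congr_right fun n =>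
    mul_comm _ _) tendsto_sq_mul_rate_div
  have h := (hL.add h1).add h2
  rw [add_zero, add_zero] at h
  refine h.congr fun n => ?_
  rw [← mul_add, ← mul_add, add_assoc]
  congr 1
  simp only [inner_sub_left, inner_sub_right]
  ring

/-- Expansion of the four-term combination of pairings. -/
lemma HasLeadingError.tendsto_pairing (hu : HasLeadingError V f u d)
    (hv : HasLeadingError V g v e) {L : ℝ}
    (hL : Tendsto (fun n : ℕ => (n : ℝ) ^ 2 * inner ℝ (d n) (e n)) atTop (𝓝 L))
    {a b : ℕ → ℝ} {C D : ℝ} (ha : HasFactorialDecay a C) (hb : HasFactorialDecay b D)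
    {a' b' : ℕ → ℕ → ℝ} (ha' : ∀ n, IsTruncation n (a' n) a)
    (hb' : ∀ n, IsTruncation n (b' n) b) :
    Tendsto (fun n : ℕ => (n : ℝ) ^ 2 * (wickPairing a b (inner ℝ f g) -
      wickPairing (a' n) b (inner ℝ (u n) g) - wickPairing a (b' n) (inner ℝ f (v n)) +
      wickPairing (a' n) (b' n) (inner ℝ (u n) (v n)))) atTop
      (𝓝 (L * wickPairing (fun k => (k + 1) * a (k + 1)) (fun k => (k + 1) * b (k + 1))
        (inner ℝ f g))) := by
  set A : ℝ := inner ℝ f g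
  set φ' := wickPairing (fun k => (k + 1) * a (k + 1)) (fun k => (k + 1) * b (k + 1)) A
  have hmain := hu.tendsto_inner hv hL
  have hBA : (fun n => inner ℝ (u n) g - A) =O[atTop] rate :=
    (hu.isBigO_inner_sub hv).neg_left.congr_left fun n => by rw [inner_sub_left]; ring
  have hCA : (fun n => inner ℝ f (v n) - A) =O[atTop] rate :=
    (hv.isBigO_inner_sub hu).neg_left.congr_left fun n => by
      rw [inner_sub_left, real_inner_comm f g, real_inner_comm f (v n)]; ring
  -- Here `⟨u, v⟩ - A` is `⟨f - u, g - v⟩` plus the two deviations already estimated.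
  have hDA : (fun n => inner ℝ (u n) (v n) - A) =O[atTop] rate := by
    have h := (isBigO_inner hu.isBigO_sub hv.isBigO_sub).trans one_div_mul_isBigO_rate
    refine ((h.add hBA).add hCA).congr_left fun n => ?_
    simp only [inner_sub_left, inner_sub_right, A]
    ring
  have hlim {B : ℕ → ℝ} (hB : (fun n => B n - A) =O[atTop] rate) : Tendsto B atTop (𝓝 A) := by
    simpa using (hB.trans_tendsto tendsto_rate).add_const A
  have hquad {B : ℕ → ℝ} (hB : (fun n => B n - A) =O[atTop] rate) :=
    tendsto_sq_mul_of_isBigO ((ha.isBigO_pairing hb (hlim hB)).trans (hB.pow 2))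
      tendsto_sq_mul_rate_sq
  have hgeo : Tendsto (fun n : ℕ => (n : ℝ) ^ 2 * (1 / 2 : ℝ) ^ n) atTop (𝓝 0) :=
    tendsto_pow_const_mul_const_pow_of_abs_lt_one 2 (by norm_num [abs_of_pos])
  have ht1 := tendsto_sq_mul_of_isBigO
    (ha.isBigO_truncation hb ha' (fun n => .refl n b) (hlim hBA)) hgeo
  have ht2 := tendsto_sq_mul_of_isBigO
    (ha.isBigO_truncation hb (fun n => .refl n a) hb' (hlim hCA)) hgeo
  have ht3 := tendsto_sq_mul_of_isBigO (ha.isBigO_truncation hb ha' hb' (hlim hDA)) hgeo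
  -- The linear terms combine exactly to `φ' * ⟨f - u, g - v⟩`; the Taylor remainders and the
  -- truncation errors vanish after multiplication by `n²`.
  have h := ((hmain.mul_const φ').add (((hquad hDA).sub (hquad hBA)).sub (hquad hCA))).add
    ((ht3.sub ht1).sub ht2)
  simp only [sub_zero, add_zero] at h
  refine h.congr fun n => ?_
  simp only [inner_sub_left, inner_sub_right]
  simp only [φ', A]
  ring

end Hilbert

end WickApprox

namespace WickApprox

variable {Ω : Type*} [MeasurableSpace Ω] {P : Measure Ω} {W : unitInterval → Ω → ℝ}

/-! ### The two approximations as Wick series -/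

lemma normSq_eq_norm_sq {f : ℝ → ℝ} (hf : MemLp f 2 unitMeasure) :
    normSq f = ‖hf.toLp f‖ ^ 2 := by
  rw [← real_inner_self_eq_norm_sq, inner_eq_integral_mul, normSq, ← integral_unitMeasure]
  refine integral_congr_ae ?_
  filter_upwards [hf.coeFn_toLp] with s h
  rw [h, sq]

lemma wickFunctional_ae_eq (hW : IsBrownianMotion W P) {f : ℝ → ℝ} (hf : MemLp f 2 unitMeasure)
    {a : ℕ → ℝ} {C : ℝ} (ha : HasFactorialDecay a C) :
    wickFunctional hW f hf a =ᵐ[P] wickVector hW a (hf.toLp f) := by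
  refine EventuallyEq.trans (ae_of_all _ fun ω => ?_) (ha.coeFn_wickVector hW (hf.toLp f)).symm
  rw [wickFunctional, normSq_eq_norm_sq hf, wienerInt]

lemma wickFunctionalDeriv_ae_eq (hW : IsBrownianMotion W P) {f : ℝ → ℝ}
    (hf : MemLp f 2 unitMeasure) {a : ℕ → ℝ} {C : ℝ} (ha : HasFactorialDecay a C) :
    wickFunctionalDeriv hW f hf a =ᵐ[P]
      wickVector hW (fun k => (k + 1) * a (k + 1)) (hf.toLp f) := by
  refine EventuallyEq.trans (ae_of_all _ fun ω => ?_)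
    (ha.shift.coeFn_wickVector hW (hf.toLp f)).symm
  rw [wickFunctionalDeriv, (ha.hasDerivAt_wickSeries _ _).deriv, normSq_eq_norm_sq hf, wienerInt]

lemma wienerIntegral_schemeVector (hW : IsBrownianMotion W P) (f : ℝ → ℝ) (n : ℕ) :
    wienerIntegral hW (schemeVector f n) =ᵐ[P] schemeInt W f n := by
  rw [schemeVector, map_sum]
  have hall : ∀ᵐ ω ∂P, ∀ k ∈ Finset.range n, wienerIntegral hW (schemeCoeff f n k •
      (indicatorL2 (gridPoint n (k + 1)) - indicatorL2 (gridPoint n k))) ω =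
        schemeCoeff f n k * (gridValue W n (k + 1) ω - gridValue W n k ω) := by
    refine (Finset.eventually_all _).2 fun k _ => ?_
    rw [map_smul, map_sub]
    filter_upwards [Lp.coeFn_smul (schemeCoeff f n k)
        (wienerIntegral hW (indicatorL2 (gridPoint n (k + 1))) -
          wienerIntegral hW (indicatorL2 (gridPoint n k))),
      Lp.coeFn_sub (wienerIntegral hW (indicatorL2 (gridPoint n (k + 1))))
        (wienerIntegral hW (indicatorL2 (gridPoint n k))),
      wienerIntegral_gridPoint hW n (k + 1), wienerIntegral_gridPoint hW n k] with ω h1 h2 h3 h4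
    rw [h1, Pi.smul_apply, h2, Pi.sub_apply, h3, h4, smul_eq_mul]
  filter_upwards [coeFn_finsetSum (Finset.range n) fun k => wienerIntegral hW (schemeCoeff f n k •
    (indicatorL2 (gridPoint n (k + 1)) - indicatorL2 (gridPoint n k))), hall] with ω h1 h2
  rw [h1, schemeInt]
  exact Finset.sum_congr rfl h2

/-- The coefficients up to index `n`. -/
def truncateCoeff (a : ℕ → ℝ) (n k : ℕ) : ℝ := if k ≤ n then a k else 0

lemma isTruncation_truncateCoeff (a : ℕ → ℝ) (n : ℕ) : IsTruncation n (truncateCoeff a n) a := by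
  intro k
  by_cases h : k ≤ n
  · exact Or.inl (if_pos h)
  · exact Or.inr ⟨not_le.1 h, if_neg h⟩

lemma truncatedApprox_ae_eq (hW : IsBrownianMotion W P) (f : ℝ → ℝ) {a : ℕ → ℝ} {C : ℝ}
    (ha : HasFactorialDecay a C) (n : ℕ) :
    truncatedApprox W f a n =ᵐ[P] wickVector hW (truncateCoeff a n) (schemeVector f n) := by
  have ha' := ha.of_abs_le (isTruncation_truncateCoeff a n).abs_le
  filter_upwards [ha'.coeFn_wickVector hW (schemeVector f n), wienerIntegral_schemeVector hW f n]
    with ω h1 h2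
  rw [h1, h2, norm_sq_schemeVector, wickSeries, truncatedApprox, tsum_eq_sum (s := Finset.range (n + 1))]
  · refine Finset.sum_congr rfl fun k hk => ?_
    rw [truncateCoeff, if_pos (Nat.lt_succ_iff.1 (Finset.mem_range.1 hk))]
  · intro k hk
    rw [truncateCoeff, if_neg fun h => hk (Finset.mem_range.2 (Nat.lt_succ_of_le h)), zero_mul]

/-- The oscillating error as a sequence indexed by all `n`. -/
noncomputable def leadingError {f : ℝ → ℝ} (hf : HasBVDeriv f) (n : ℕ) : Lp ℝ 2 unitMeasure :=
  if hn : 0 < n then oscVector hf hn else 0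

lemma hasLeadingError_schemeVector {f : ℝ → ℝ} (hf : HasBVDeriv f) :
    HasLeadingError gridSubspace (hf.memLp.toLp f) (schemeVector f) (leadingError hf) where
  mem := schemeVector_mem f
  perp n := by
    rw [leadingError]
    split_ifs with hn
    · exact oscVector_mem_orthogonal hf hn
    · exact zero_mem _
  lead := by
    obtain ⟨M, hM0, hM⟩ := norm_oscVector_le hf
    refine Asymptotics.IsBigO.of_bound M ?_
    filter_upwards [eventually_gt_atTop 0] with n hn
    rw [leadingError, dif_pos hn, Real.norm_eq_abs, abs_of_nonneg (by positivity), mul_one_div]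
    exact hM n hn
  rem := by
    obtain ⟨K, hK0, hK⟩ := norm_sub_schemeVector_sub_oscVector_le hf
    refine Asymptotics.IsBigO.of_bound K ?_
    filter_upwards [eventually_gt_atTop 0] with n hn
    rw [leadingError, dif_pos hn, Real.norm_eq_abs, abs_of_nonneg (rate_nonneg n)]
    refine abs_le_of_sq_le_sq' ((hK n hn).trans (le_of_eq ?_))
      (mul_nonneg hK0 (rate_nonneg n)) |>.2
    rw [rate, mul_pow, mul_pow, div_pow 1 (√(n : ℝ)), Real.sq_sqrt (by positivity)]
    ring

/-- Projection onto `V n` fixes `u n` and kills `d n`, so the new remainder is the old one minus its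
projection, at most twice as large. The optimal approximation thus inherits the leading error of the
explicit scheme. -/
lemma HasLeadingError.starProjection {H : Type*} [NormedAddCommGroup H] [InnerProductSpace ℝ H]
    {V : ℕ → Submodule ℝ H} [∀ n, (V n).HasOrthogonalProjection] {f : H} {u d : ℕ → H}
    (h : HasLeadingError V f u d) :
    HasLeadingError V f (fun n => (V n).starProjection f) d where
  mem n := Submodule.starProjection_apply_mem _ f
  perp := h.perp
  lead := h.lead
  rem := by
    refine Asymptotics.IsBigO.trans (Asymptotics.IsBigO.of_bound 2
      (Eventually.of_forall fun n => ?_)) h.rem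
    have h1 : (V n).starProjection (u n) = u n := Submodule.starProjection_eq_self_iff.2 (h.mem n)
    have h2 : (V n).starProjection (d n) = 0 :=
      ((V n).starProjection_apply_eq_zero_iff).2 (h.perp n)
    have h3 : f - (V n).starProjection f - d n =
        (f - u n - d n) - (V n).starProjection (f - u n - d n) := by
      rw [map_sub, map_sub, h1, h2]
      abel
    rw [h3]
    refine (norm_sub_le _ _).trans ?_
    have := (V n).norm_starProjection_apply_le (f - u n - d n)
    linarith

/-- Both errors are differences of Wick series with the same leading error of the integrand. -/
lemma exists_hasLeadingError (hW : IsBrownianMotion W P) {f : ℝ → ℝ} (hf : HasBVDeriv f)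
    {a : ℕ → ℝ} {C : ℝ} (ha : HasFactorialDecay a C) {F : Ω → ℝ}
    (hF : F =ᵐ[P] wickVector hW a (hf.memLp.toLp f)) {x : ℕ → Ω → ℝ}
    (hx : x ∈ ({optimalError W P F, truncatedError W f a F} : Set (ℕ → Ω → ℝ))) :
    ∃ (a' : ℕ → ℕ → ℝ) (u : ℕ → Lp ℝ 2 unitMeasure), (∀ n, IsTruncation n (a' n) a) ∧
      HasLeadingError gridSubspace (hf.memLp.toLp f) u (leadingError hf) ∧
      ∀ n, x n =ᵐ[P]
        (wickVector hW a (hf.memLp.toLp f) - wickVector hW (a' n) (u n) : Lp ℝ 2 P) := by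
  rcases hx with rfl | rfl
  · refine ⟨fun _ => a, _, fun n => .refl n a, (hasLeadingError_schemeVector hf).starProjection,
      fun n => ?_⟩
    exact (hF.sub (condExp_wickVector hW ha n _ hF)).trans (Lp.coeFn_sub _ _).symm
  · refine ⟨truncateCoeff a, schemeVector f, isTruncation_truncateCoeff a,
      hasLeadingError_schemeVector hf, fun n => ?_⟩
    exact (hF.sub (truncatedApprox_ae_eq hW f ha n)).trans (Lp.coeFn_sub _ _).symm

/-- The factor `n²` leaves `1/12` times a Riemann sum of `f' g'`, which again has bounded variation.
-/
lemma tendsto_inner_leadingError {f g : ℝ → ℝ} (hf : HasBVDeriv f) (hg : HasBVDeriv g) :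
    Tendsto (fun n : ℕ => (n : ℝ) ^ 2 * inner ℝ (leadingError hf n) (leadingError hg n)) atTop
      (𝓝 (1 / 12 * ∫ s in (0 : ℝ)..1, unitDeriv f s * unitDeriv g s)) := by
  have hq : BoundedVariationOn (fun s => unitDeriv f s * unitDeriv g s) (Icc 0 1) :=
    hf.boundedVariation.mul hg.boundedVariation
  refine ((tendsto_riemannSum hq).const_mul (1 / 12)).congr' ?_
  filter_upwards [eventually_gt_atTop 0] with n hn
  have hn' : (n : ℝ) ≠ 0 := by positivity
  rw [leadingError, leadingError, dif_pos hn, dif_pos hn, inner_oscVector]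
  field_simp

lemma integral_mul_eq_inner {x y : Ω → ℝ} {X Y : Lp ℝ 2 P} (hx : x =ᵐ[P] X) (hy : y =ᵐ[P] Y) :
    ∫ ω, x ω * y ω ∂P = inner ℝ X Y := by
  rw [L2.inner_def]
  refine integral_congr_ae ?_
  filter_upwards [hx, hy] with ω h1 h2
  simp [h1, h2, mul_comm]

end WickApprox

theorem mainTheorem5 {Ω : Type*} [MeasurableSpace Ω] (P : Measure Ω) [IsProbabilityMeasure P]
    (W : unitInterval → Ω → ℝ) (hW : WickApprox.IsBrownianMotion W P)
    (f g : ℝ → ℝ) (hf : WickApprox.HasBVDeriv f) (hg : WickApprox.HasBVDeriv g)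
    (a b : ℕ → ℝ) (ha : WickApprox.IsWickAnalytic a) (hb : WickApprox.IsWickAnalytic b)
    (F F' G G' : Ω → ℝ)
    (hF : F = WickApprox.wickFunctional hW f hf.memLp a)
    (hF' : F' = WickApprox.wickFunctionalDeriv hW f hf.memLp a)
    (hG : G = WickApprox.wickFunctional hW g hg.memLp b)
    (hG' : G' = WickApprox.wickFunctionalDeriv hW g hg.memLp b) :
    (MemLp F 2 P ∧ MemLp F' 2 P ∧ MemLp G 2 P ∧ MemLp G' 2 P) ∧
    ∀ x ∈ ({WickApprox.optimalError W P F, WickApprox.truncatedError W f a F} :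
        Set (ℕ → Ω → ℝ)),
    ∀ y ∈ ({WickApprox.optimalError W P G, WickApprox.truncatedError W g b G} :
        Set (ℕ → Ω → ℝ)),
      (∀ n, Integrable (fun ω => x n ω * y n ω) P) ∧
      Tendsto (fun n : ℕ => (n : ℝ) ^ 2 * ∫ ω, x n ω * y n ω ∂P) atTop
        (𝓝 (1 / 12 * (∫ s in (0 : ℝ)..1, WickApprox.unitDeriv f s * WickApprox.unitDeriv g s) *
          ∫ ω, F' ω * G' ω ∂P)) := by
  obtain ⟨C, hC⟩ := ha.exists_hasFactorialDecay
  obtain ⟨D, hD⟩ := hb.exists_hasFactorialDecay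
  have hFv := WickApprox.wickFunctional_ae_eq hW hf.memLp hC
  have hFv' := WickApprox.wickFunctionalDeriv_ae_eq hW hf.memLp hC
  have hGv := WickApprox.wickFunctional_ae_eq hW hg.memLp hD
  have hGv' := WickApprox.wickFunctionalDeriv_ae_eq hW hg.memLp hD
  rw [← hF] at hFv
  rw [← hF'] at hFv'
  rw [← hG] at hGv
  rw [← hG'] at hGv'
  refine ⟨⟨(Lp.memLp _).ae_eq hFv.symm, (Lp.memLp _).ae_eq hFv'.symm,
    (Lp.memLp _).ae_eq hGv.symm, (Lp.memLp _).ae_eq hGv'.symm⟩, fun x hx y hy => ?_⟩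
  obtain ⟨a', u, ha', hu, hxu⟩ := WickApprox.exists_hasLeadingError hW hf hC hFv hx
  obtain ⟨b', v, hb', hv, hyv⟩ := WickApprox.exists_hasLeadingError hW hg hD hGv hy
  refine ⟨fun n => ((Lp.memLp _).ae_eq (hxu n).symm).integrable_mul
    ((Lp.memLp _).ae_eq (hyv n).symm), ?_⟩
  -- `E[F' G']` becomes the pairing of the shifted coefficients at `⟨f, g⟩`, and expanding the inner
  -- product of the two errors gives the four pairings of `tendsto_pairing`.
  rw [WickApprox.integral_mul_eq_inner hFv' hGv',
    WickApprox.inner_wickVector hW hC.shift hD.shift]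
  refine (hu.tendsto_pairing hv (WickApprox.tendsto_inner_leadingError hf hg) hC hD ha'
    hb').congr fun n => ?_
  have hCn := hC.of_abs_le (ha' n).abs_le
  have hDn := hD.of_abs_le (hb' n).abs_le
  rw [WickApprox.integral_mul_eq_inner (hxu n) (hyv n), inner_sub_left, inner_sub_right,
    inner_sub_right, WickApprox.inner_wickVector hW hC hD, WickApprox.inner_wickVector hW hC hDn,
    WickApprox.inner_wickVector hW hCn hD, WickApprox.inner_wickVector hW hCn hDn]
  ring
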